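/- Let $N\ge 1$ be an integer, and let $u,v\in\mathbb Z$ be such that, for the quadratic order $R=\mathbb Z[\alpha]=\mathbb Z[X]/(X^2-uX+v)$, the discriminant $u^2-4v$ is coprime to $N$ and every prime dividing $N$ is inert in $R$. Let $C_{\mathrm{ns}}(N)\le \mathrm{GL}_2(\mathbb Z/N\mathbb Z)$ be the nonsplit Cartan subgroup: the group of matrices, in the basis $1,\alpha$ of $A=R/NR=(\mathbb Z/N\mathbb Z)[\alpha]$, of multiplication by the units of $A$. For each prime $p\mid N$, with $q=p^{\nu_p(N)}$ the exact power of $p$ dividing $N$, let $w_p\in \mathrm{GL}_2(\mathbb Z/N\mathbb Z)$ be the matrix which modulo $q$ is that of the involution $1\mapsto 1,\ \alpha\mapsto u-\alpha$, and modulo $N/q$ is the identity. Let $C_{\mathrm{ns}}^*(N)$ be the group generated by $C_{\mathrm{ns}}(N)$ and all $w_p$, $p\mid N$; let $X_{\mathrm{ns}}^*(N)$ be the associated modular curve, and put $\Gamma=C_{\mathrm{ns}}^*(N)\cap \mathrm{SL}_2(\mathbb Z/N\mathbb Z)$. Let $\varepsilon_2^*$ and $\varepsilon_3^*$ be the numbers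 of elliptic points of order $2$ and $3$ on $X_{\mathrm{ns}}^*(N)$, that is, the numbers of right cosets in $\Gamma\backslash\mathrm{SL}_2(\mathbb Z/N\mathbb Z)$ fixed by right multiplication by $\begin{pmatrix}0&-1\\1&0\end{pmatrix}$ and by $\begin{pmatrix}0&-1\\1&-1\end{pmatrix}$ respectively; and let $\varepsilon_\infty^*$ be the number of cusps, that is, the number of orbits of right multiplication by powers of $\begin{pmatrix}1&1\\0&1\end{pmatrix}$ on $\Gamma\backslash\mathrm{SL}_2(\mathbb Z/N\mathbb Z)$. Write $\varphi$ for Euler's function, $\omega(N)$ for the number of primes dividing $N$, and $\nu_p(N)$ for the exponent of $p$ in $N$. Then \begin{align*} \varepsilon_\infty^* &= \begin{cases}\varphi(N)/2^{\omega(N)-1} & \text{if } 2\mid N \text{ and } 4\nmid N,\\ \varphi(N)/2^{\omega(N)} & \text{otherwise,}\end{cases}\\ \varepsilon_3^* &= \begin{cases}1 & \text{if } p\equiv 2 \pmod 3 \text{ for every prime } p\mid N,\\ 0 & \text{otherwise,}\end{cases}\\ \varepsilon_2^* &= \delta(N)\cdot\prod_{\substack{p\mid N\\ p\equiv 1 \bmod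 4}} \frac{p^{\nu_p(N)-1}(p-1)}{2}\cdot\prod_{\substack{p\mid N\\ p\equiv 3 \bmod 4}}\left(1+\frac{p^{\nu_p(N)-1}(p+1)}{2}\right), \end{align*} where the products run over primes $p$, and $\delta(N)=2^{\nu_2(N)-1}$ if $N$ is even and $\delta(N)=1$ if $N$ is odd. -/

import Mathlib

noncomputable section

namespace NonsplitCartan

open Matrix

/-! ### Cosets, elliptic points and cusps -/

/-- The right coset space `Γ \ G`, i.e. the set of cosets `Γ x`. -/
def RightCosets {G : Type*} [Group G] (Γ : Subgroup G) : Type _ :=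
  Quotient (QuotientGroup.rightRel Γ)

/-- The right translation action of `G` on `Γ \ G`, `(Γ x) · g = Γ (x g)`, written as a left action
of the opposite group. -/
instance rightCosetsMulAction {G : Type*} [Group G] (Γ : Subgroup G) : MulAction Gᵐᵒᵖ (RightCosets Γ) where
  smul g := Quotient.map (fun x => x * g.unop) (by
    intro x y h
    have h' : y * x⁻¹ ∈ Γ := QuotientGroup.rightRel_apply.1 h
    exact QuotientGroup.rightRel_apply.2 (by simpa [mul_assoc] using h'))
  one_smul := by
    rintro ⟨x⟩
    exact congrArg (Quotient.mk (QuotientGroup.rightRel Γ)) (mul_one x)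
  mul_smul := by
    rintro g h ⟨x⟩
    exact congrArg (Quotient.mk (QuotientGroup.rightRel Γ)) (mul_assoc x h.unop g.unop).symm

/-- The group `H ∩ SL₂(ℤ/N)`, as a subgroup of `SL₂(ℤ/N)`. -/
def slPart {N : ℕ} (H : Subgroup (GL (Fin 2) (ZMod N))) :
    Subgroup (SpecialLinearGroup (Fin 2) (ZMod N)) :=
  H.comap SpecialLinearGroup.toGL

/-- The matrix `(0, -1; 1, 0)` in `SL₂(ℤ/N)`. -/
def matS (N : ℕ) : SpecialLinearGroup (Fin 2) (ZMod N) :=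
  ⟨!![0, -1; 1, 0], by simp [Matrix.det_fin_two]⟩

/-- The matrix `(0, -1; 1, -1)` in `SL₂(ℤ/N)`. -/
def matR (N : ℕ) : SpecialLinearGroup (Fin 2) (ZMod N) :=
  ⟨!![0, -1; 1, -1], by simp [Matrix.det_fin_two]⟩

/-- The matrix `(1, 1; 0, 1)` in `SL₂(ℤ/N)`. -/
def matT (N : ℕ) : SpecialLinearGroup (Fin 2) (ZMod N) :=
  ⟨!![1, 1; 0, 1], by simp [Matrix.det_fin_two]⟩

/-- The number of elliptic points of order 2 on `X_H`: the number of right cosets of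
`H ∩ SL₂(ℤ/N)` in `SL₂(ℤ/N)` fixed by right multiplication by `(0, -1; 1, 0)`. -/
def numElliptic2 {N : ℕ} (H : Subgroup (GL (Fin 2) (ZMod N))) : ℕ :=
  Nat.card (MulAction.fixedBy (RightCosets (slPart H)) (MulOpposite.op (matS N)))

/-- The number of elliptic points of order 3 on `X_H`: the number of right cosets of
`H ∩ SL₂(ℤ/N)` in `SL₂(ℤ/N)` fixed by right multiplication by `(0, -1; 1, -1)`. -/
def numElliptic3 {N : ℕ} (H : Subgroup (GL (Fin 2) (ZMod N))) : ℕ :=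
  Nat.card (MulAction.fixedBy (RightCosets (slPart H)) (MulOpposite.op (matR N)))

/-- The number of cusps on `X_H`: the number of orbits of right multiplication by (powers of)
`(1, 1; 0, 1)` on the right cosets of `H ∩ SL₂(ℤ/N)` in `SL₂(ℤ/N)`. -/
def numCusps {N : ℕ} (H : Subgroup (GL (Fin 2) (ZMod N))) : ℕ :=
  Nat.card (MulAction.orbitRel.Quotient (Subgroup.zpowers (MulOpposite.op (matT N)))
    (RightCosets (slPart H)))

/-! ### The nonsplit Cartan subgroup and the group `C_ns^*(N)` -/

/-- The order `ℤ[α]`, where `α² - u α + v = 0`. -/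
abbrev QuadOrder (u v : ℤ) : Type := QuadraticAlgebra ℤ (-v) u

/-- The algebra `A = ℤ[α] / N ℤ[α] = (ℤ/N)[α]`, where `α² - u α + v = 0`. -/
abbrev QuadMod (N : ℕ) (u v : ℤ) : Type := QuadraticAlgebra (ZMod N) (-(v : ZMod N)) (u : ZMod N)

/-- The order `ℤ[α]`, `α² - u α + v = 0`, is admissible for the level `N`: its discriminant is
coprime to `N`, and every prime divisor of `N` is inert in it. -/
structure IsNonsplit (N : ℕ) (u v : ℤ) : Prop where
  disc_coprime : IsCoprime (u ^ 2 - 4 * v) (N : ℤ)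
  inert : ∀ p : ℕ, p.Prime → p ∣ N → (Ideal.span {(p : QuadOrder u v)}).IsPrime

/-- The nonsplit Cartan subgroup `C_ns(N)`: the matrices, in the basis `1, α` of `(ℤ/N)[α]`, of
multiplication by the units of `(ℤ/N)[α]`. -/
def cartan (N : ℕ) (u v : ℤ) : Subgroup (GL (Fin 2) (ZMod N)) :=
  (Units.map (Algebra.leftMulMatrix
    (QuadraticAlgebra.basis (-(v : ZMod N)) (u : ZMod N)) :
      QuadMod N u v →* Matrix (Fin 2) (Fin 2) (ZMod N))).range

/-- The matrix of the involution `1 ↦ 1`, `α ↦ u - α` in the basis `1, α` (columns are images). -/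
def conjMatrix (R : Type*) [CommRing R] (u : ℤ) : Matrix (Fin 2) (Fin 2) R := !![1, (u : R); 0, -1]

/-- `w` is the involution attached to the prime `p`: if `q` is the exact power of `p` dividing `N`,
then `w` is the involution `α ↦ u - α` modulo `q` and the identity modulo `N / q`. -/
def IsInvolutionAt (N : ℕ) (u : ℤ) (p : ℕ) (w : GL (Fin 2) (ZMod N)) : Prop :=
  w.val.map (ZMod.castHom (Nat.ordProj_dvd N p) (ZMod (p ^ N.factorization p))) =
      conjMatrix _ u ∧
    w.val.map (ZMod.castHom (Nat.ordCompl_dvd N p) (ZMod (N / p ^ N.factorization p))) = 1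

/-- The group `C_ns^*(N)`, generated by the nonsplit Cartan subgroup together with the involutions
attached to the primes dividing `N`. -/
def cartanStar (N : ℕ) (u v : ℤ) : Subgroup (GL (Fin 2) (ZMod N)) :=
  cartan N u v ⊔ Subgroup.closure {w | ∃ p : ℕ, p.Prime ∧ p ∣ N ∧ IsInvolutionAt N u p w}

end NonsplitCartan

end

noncomputable section

namespace NonsplitCartan

open Matrix

/-! ### Lifting along surjections with nilpotent kernel -/

section Lifting

variable {R F : Type*} [CommRing R] [Field F] (π : R →+* F)

/-! Call a matrix over ℤ/N α-like if it has trace u and determinant v. A twist of X, given by an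
idempotent e of ℤ/N, is X where e is 0 and u - X where e is 1. The group `C_ns^*(N)` is exactly the
set of g for which gαg⁻¹ is a twist of α (`cartanStar_eq`), so x ↦ x⁻¹αx identifies Γ\SL₂ with the
α-like matrices modulo twists (`coset_eq_iff`). Every α-like matrix is reached because the norm from
(ℤ/N)[α] represents every unit (`IsAlphaLike.exists_conjBy`), and the 2^ω(N) twists act freely
because the discriminant is a unit (`IsAlphaLike.twist_injective`).

Hence 2^ω(N) times the number of cosets fixed by s is the number of α-like X with s⁻¹Xs a twist of X
(`card_fixedBy_mul`). By the Chinese remainder theorem this is a product over prime powers p^k,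
where e is 0 or 1. In order 3 only e = 0 survives, and X is given by a root of a quadratic of
discriminant -3(u² - 4v): two roots if p ≡ 2 mod 3, none otherwise. In order 2, e = 0 gives two
matrices if p ≡ 3 mod 4 and none otherwise. For p odd, e = 1 gives the conic x² + y² = u² - 4v, with
p^(k-1)(p - 1) or p^(k-1)(p + 1) points as p ≡ 1 or 3 mod 4; for p = 2 it gives 2^k matrices.

For cusps, the lower left entry c of an α-like matrix is a unit, and conjugation by powers of T
preserves c while moving the upper left entry through all of ℤ/N. A twist multiplies c by 1 - 2e, so
cusps are the units modulo these signs (`numCusps_mul`). The sign group has order 2^ω(N), halved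
when 2 exactly divides N because 1 = -1 modulo 2 (`card_signs`). -/

theorem isUnit_of_map_ne_zero (hs : Function.Surjective π)
    (hk : ∀ x, π x = 0 → IsNilpotent x) {x : R} (hx : π x ≠ 0) : IsUnit x := by
  obtain ⟨y, hy⟩ := hs (π x)⁻¹
  have h1 : IsNilpotent (1 - x * y) := hk _ (by simp [hy, hx])
  have h2 : IsUnit (x * y) := by simpa using h1.isUnit_one_sub
  exact isUnit_of_mul_isUnit_left h2

/-- A simple root of a quadratic polynomial lifts uniquely along a surjection onto a field with
nilpotent kernel. -/
theorem existsUnique_lift_quadratic_root (hs : Function.Surjective π)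
    (hk : ∀ x, π x = 0 → IsNilpotent x) (A B C : R) (r : F)
    (hr : π A * r ^ 2 + π B * r + π C = 0) (hr' : 2 * π A * r + π B ≠ 0) :
    ∃! x : R, A * x ^ 2 + B * x + C = 0 ∧ π x = r := by
  obtain ⟨y, rfl⟩ := hs r
  let P : Polynomial R := Polynomial.C A * Polynomial.X ^ 2 + Polynomial.C B * Polynomial.X +
    Polynomial.C C
  have hP : ∀ x : R, Polynomial.aeval x P = A * x ^ 2 + B * x + C := by
    intro x; simp [P]
  have hP' : Polynomial.aeval y (Polynomial.derivative P) = 2 * A * y + B := by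
    simp [P]; ring
  have h1 : IsNilpotent (Polynomial.aeval y P) := by
    rw [hP]; exact hk _ (by simpa using hr)
  have h2 : IsUnit (Polynomial.aeval y (Polynomial.derivative P)) := by
    rw [hP']; exact isUnit_of_map_ne_zero π hs hk (by simpa only [map_add, map_mul, map_ofNat] using hr')
  obtain ⟨x, ⟨hx1, hx2⟩, hx⟩ := Polynomial.existsUnique_nilpotent_sub_and_aeval_eq_zero h1 h2
  rw [hP] at hx2
  refine ⟨x, ⟨hx2, ?_⟩, fun z hz => hx z ⟨hk _ (by simp [hz.2]), by rw [hP]; exact hz.1⟩⟩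
  have := (hx1.map π).eq_zero
  rw [map_sub, sub_eq_zero] at this
  exact this.symm

/-- Since every root over the field is simple, each has exactly one lift. Simplicity is asked of the
roots rather than of the discriminant, and 2 need not be invertible, so residue characteristic 2 is
covered. -/
theorem card_quadratic_roots_eq (hs : Function.Surjective π)
    (hk : ∀ x, π x = 0 → IsNilpotent x) (A B C : R)
    (hd : ∀ r, π A * r ^ 2 + π B * r + π C = 0 → 2 * π A * r + π B ≠ 0) :
    Nat.card {x : R // A * x ^ 2 + B * x + C = 0} =
      Nat.card {r : F // π A * r ^ 2 + π B * r + π C = 0} := by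
  refine Nat.card_congr (Equiv.ofBijective
    (fun x => ⟨π x.1, by simpa using congrArg π x.2⟩) ⟨?_, ?_⟩)
  · rintro ⟨x, hx⟩ ⟨y, hy⟩ hxy
    have hxy : π x = π y := congrArg Subtype.val hxy
    have hx0 : π A * (π x) ^ 2 + π B * π x + π C = 0 := by simpa using congrArg π hx
    exact Subtype.ext ((existsUnique_lift_quadratic_root π hs hk A B C (π x) hx0
      (hd _ hx0)).unique ⟨hx, rfl⟩ ⟨hy, hxy.symm⟩)
  · rintro ⟨r, hr⟩
    obtain ⟨x, ⟨hx, hxr⟩, -⟩ := existsUnique_lift_quadratic_root π hs hk A B C r hr (hd _ hr)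
    exact ⟨⟨x, hx⟩, Subtype.ext hxr⟩

end Lifting

/-! ### Reduction of `ℤ/p^k` modulo `p` -/

section PrimePower

variable {p k : ℕ}

/-- The reduction map `ℤ/p^k → ℤ/p`. -/
def reduction (p : ℕ) {k : ℕ} (hk : k ≠ 0) : ZMod (p ^ k) →+* ZMod p :=
  ZMod.castHom (dvd_pow_self p hk) (ZMod p)

theorem reduction_surjective (hk : k ≠ 0) : Function.Surjective (reduction p hk) :=
  ZMod.ringHom_surjective _

theorem isNilpotent_of_reduction_eq_zero (hk : k ≠ 0) (x : ZMod (p ^ k))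
    (hx : reduction p hk x = 0) : IsNilpotent x := by
  obtain ⟨n, rfl⟩ := ZMod.intCast_surjective x
  rw [map_intCast, ZMod.intCast_zmod_eq_zero_iff_dvd _ p] at hx
  obtain ⟨m, rfl⟩ := hx
  refine ⟨k, ?_⟩
  have : ((p ^ k : ℕ) : ZMod (p ^ k)) = 0 := ZMod.natCast_self _
  push_cast at this ⊢
  rw [mul_pow, this, zero_mul]

variable [Fact p.Prime]

theorem isUnit_iff_reduction_ne_zero (hk : k ≠ 0) (x : ZMod (p ^ k)) :
    IsUnit x ↔ reduction p hk x ≠ 0 :=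
  ⟨fun h => (h.map _).ne_zero, isUnit_of_map_ne_zero _ (reduction_surjective hk)
    (isNilpotent_of_reduction_eq_zero hk)⟩

theorem two_ne_zero_of_odd (hp : p ≠ 2) : (2 : ZMod p) ≠ 0 := by
  intro h
  have : ((2 : ℕ) : ZMod p) = 0 := by exact_mod_cast h
  rw [ZMod.natCast_eq_zero_iff] at this
  exact hp ((Nat.prime_dvd_prime_iff_eq Fact.out Nat.prime_two).1 this)

/-- After Hensel lifting reduces the count to ℤ/p, the substitution y = 2Ax + B turns roots into
square roots of the discriminant. -/
theorem card_quadratic_roots_primePow (hk : k ≠ 0) (hp : p ≠ 2) (A B C : ℤ)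
    (hA : (A : ZMod p) ≠ 0) (hD : ((B ^ 2 - 4 * A * C : ℤ) : ZMod p) ≠ 0) :
    (Nat.card {x : ZMod (p ^ k) // (A : ZMod (p ^ k)) * x ^ 2 + B * x + C = 0} : ℤ) =
      legendreSym p (B ^ 2 - 4 * A * C) + 1 := by
  have h2 := two_ne_zero_of_odd hp
  have key : Nat.card {x : ZMod (p ^ k) // (A : ZMod (p ^ k)) * x ^ 2 + B * x + C = 0} =
      Nat.card {x : ZMod p // (A : ZMod p) * x ^ 2 + B * x + C = 0} := by
    have := card_quadratic_roots_eq (reduction p hk) (reduction_surjective hk)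
      (isNilpotent_of_reduction_eq_zero hk) A B C ?_
    · simpa using this
    · intro r hr h
      simp only [map_intCast] at hr h
      apply hD
      push_cast
      -- B² - 4AC = (2Ar + B)² - 4A(Ar² + Br + C), so a double root would kill the discriminant.
      linear_combination (-4 * A : ZMod p) * hr + (2 * A * r + B) * h
  rw [key, ← legendreSym.card_sqrts p hp, Set.toFinset_card, ← Nat.card_eq_fintype_card]
  congr 1
  refine Nat.card_congr (Equiv.ofBijective (fun x => ⟨2 * A * x.1 + B, ?_⟩) ⟨?_, ?_⟩)
  · simp only [Set.mem_ofPred_eq]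
    push_cast
    linear_combination (4 * A : ZMod p) * x.2
  · rintro ⟨x, hx⟩ ⟨y, hy⟩ hxy
    have hxy : 2 * A * x + B = 2 * A * y + B := congrArg Subtype.val hxy
    exact Subtype.ext (mul_left_cancel₀ (mul_ne_zero h2 hA) (add_right_cancel hxy))
  · rintro ⟨y, hy⟩
    simp only [Set.mem_ofPred_eq] at hy
    have hz : 2 * A * ((y - B) / (2 * A)) = y - B := by field_simp
    refine ⟨⟨(y - B) / (2 * A), ?_⟩, Subtype.ext (by simp only [hz]; ring)⟩
    have h4A : (4 * A : ZMod p) ≠ 0 := by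
      have : (4 : ZMod p) = 2 * 2 := by norm_num
      rw [this]; exact mul_ne_zero (mul_ne_zero h2 h2) hA
    apply mul_left_cancel₀ h4A
    push_cast at hy
    set z := (y - B) / (2 * A : ZMod p)
    linear_combination hy + (2 * A * z + y + B) * hz

theorem card_idempotents_primePow (hk : k ≠ 0) :
    Nat.card {e : ZMod (p ^ k) // e * e = e} = 2 := by
  have h := card_quadratic_roots_eq (reduction p hk) (reduction_surjective hk)
    (isNilpotent_of_reduction_eq_zero hk) 1 (-1) 0 ?_
  · have h1 : Nat.card {e : ZMod (p ^ k) // e * e = e} =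
        Nat.card {x : ZMod (p ^ k) // 1 * x ^ 2 + -1 * x + 0 = 0} :=
      Nat.card_congr (Equiv.subtypeEquivRight fun x => by
        rw [← sub_eq_zero]; ring_nf)
    rw [h1, h]
    have h2 : {r : ZMod p | reduction p hk 1 * r ^ 2 + reduction p hk (-1) * r
        + reduction p hk 0 = 0} = {0, 1} := by
      ext r
      simp only [map_one, map_neg, map_zero, Set.mem_ofPred_eq, Set.mem_insert_iff,
        Set.mem_singleton_iff]
      rw [show 1 * r ^ 2 + -1 * r + 0 = r * (r - 1) by ring, mul_eq_zero, sub_eq_zero]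
    change Nat.card {r : ZMod p | reduction p hk 1 * r ^ 2 + reduction p hk (-1) * r
        + reduction p hk 0 = 0} = 2
    rw [h2, Nat.card_coe_set_eq, Set.ncard_pair zero_ne_one]
  · intro r hr h
    simp only [map_one, map_neg, map_zero] at hr h
    have : (1 : ZMod p) = 0 := by linear_combination (-4 : ZMod p) * hr + (2 * r - 1) * h
    exact one_ne_zero this

theorem idempotent_primePow (hk : k ≠ 0) {e : ZMod (p ^ k)} (he : e * e = e) :
    e = 0 ∨ e = 1 := by
  have h0 : IsUnit e ∨ IsUnit (1 - e) := by
    simp only [isUnit_iff_reduction_ne_zero hk, ← not_and_or]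
    rintro ⟨h1, h2⟩
    rw [map_sub, h1] at h2
    simp at h2
  rcases h0 with h | h
  · right; exact h.mul_left_cancel (by simpa using he)
  · left; exact h.mul_left_cancel (by linear_combination -he)

end PrimePower

/-! ### Local arithmetic at an inert prime -/

theorem zmod_two_sq_add_self (r : ZMod 2) : r ^ 2 + r = 0 := by
  revert r; decide

theorem zmod_two_eq_one {c : ZMod 2} (hc : c ≠ 0) : c = 1 := by
  revert c; decide

section PrimePower

variable {p k : ℕ} [Fact p.Prime] {u v : ℤ}

theorem legendreSym_disc (hp : p ≠ 2) (hr : ∀ r : ZMod p, r ^ 2 - u * r + v ≠ 0) :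
    legendreSym p (u ^ 2 - 4 * v) = -1 := by
  rw [legendreSym.eq_neg_one_iff]
  rintro ⟨t, ht⟩
  have h2 := two_ne_zero_of_odd hp
  refine hr ((u + t) / 2) ?_
  have hz : 2 * ((u + t) / 2 : ZMod p) = u + t := by field_simp
  have h4 : (4 : ZMod p) ≠ 0 := by
    rw [show (4 : ZMod p) = 2 * 2 by norm_num]; exact mul_ne_zero h2 h2
  apply mul_left_cancel₀ h4
  push_cast at ht
  set z := (u + t : ZMod p) / 2
  linear_combination (2 * z - u + t) * hz - ht

theorem disc_ne_zero (hp : p ≠ 2) (hr : ∀ r : ZMod p, r ^ 2 - u * r + v ≠ 0) :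
    ((u ^ 2 - 4 * v : ℤ) : ZMod p) ≠ 0 := by
  intro h
  have := legendreSym_disc hp hr
  rw [(legendreSym.eq_zero_iff p _).2 h] at this
  norm_num at this

/-- The only quadratic without roots over 𝔽₂ is X² + X + 1. -/
theorem intCast_eq_one_of_two (hr : ∀ r : ZMod 2, r ^ 2 - u * r + v ≠ 0) :
    (u : ZMod 2) = 1 ∧ (v : ZMod 2) = 1 := by
  generalize (u : ZMod 2) = a at *
  generalize (v : ZMod 2) = b at *
  revert a b
  decide

/-- Through y = 2w + 1, square roots of -3 correspond to roots of w² + w + 1, the elements of order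
3 in a group of order p - 1. -/
theorem isSquare_neg_three_iff (hp : p ≠ 2) (hp3 : p ≠ 3) :
    IsSquare (-3 : ZMod p) ↔ p % 3 = 1 := by
  have hpp : p.Prime := Fact.out
  have h2 := two_ne_zero_of_odd hp
  have h3 : (3 : ZMod p) ≠ 0 := by
    intro h
    have : ((3 : ℕ) : ZMod p) = 0 := by exact_mod_cast h
    rw [ZMod.natCast_eq_zero_iff] at this
    exact hp3 ((Nat.prime_dvd_prime_iff_eq hpp Nat.prime_three).1 this)
  have hcard : Fintype.card (ZMod p)ˣ = p - 1 := ZMod.card_units p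
  have : Fact (Nat.Prime 3) := ⟨Nat.prime_three⟩
  have h1p := hpp.one_lt
  constructor
  · rintro ⟨y, hy⟩
    obtain ⟨w, hw⟩ : ∃ w : ZMod p, 2 * w = y - 1 := ⟨(y - 1) / 2, by field_simp⟩
    have h4 : (4 : ZMod p) ≠ 0 := by
      rw [show (4 : ZMod p) = 2 * 2 by norm_num]; exact mul_ne_zero h2 h2
    have hw2 : w ^ 2 + w + 1 = 0 := by
      apply mul_left_cancel₀ h4
      linear_combination (2 * w + y + 1) * hw - hy
    have hw3 : w ^ 3 = 1 := by linear_combination (w - 1) * hw2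
    have hw1 : w ≠ 1 := by
      rintro rfl
      exact h3 (by linear_combination hw2)
    have hw0 : w ≠ 0 := by rintro rfl; simp at hw2
    have ho : orderOf (Units.mk0 w hw0) = 3 := by
      apply orderOf_eq_prime
      · ext; simpa using hw3
      · intro h; exact hw1 (by simpa using congrArg Units.val h)
    have := orderOf_dvd_card (x := Units.mk0 w hw0)
    rw [ho, hcard] at this
    omega
  · intro h
    obtain ⟨w, hw⟩ := exists_prime_orderOf_dvd_card (G := (ZMod p)ˣ) 3 (by rw [hcard]; omega)
    have hw3 : w ^ 3 = 1 := by rw [← hw]; exact pow_orderOf_eq_one w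
    have hw1 : (w : ZMod p) ≠ 1 := by
      intro h
      rw [Units.val_eq_one] at h
      rw [h, orderOf_one] at hw
      norm_num at hw
    have hw3' : (w : ZMod p) ^ 3 = 1 := by rw [← Units.val_pow_eq_pow_val, hw3, Units.val_one]
    have hw2 : (w : ZMod p) ^ 2 + w + 1 = 0 := by
      apply mul_left_cancel₀ (sub_ne_zero.2 hw1)
      linear_combination hw3'
    exact ⟨2 * w + 1, by linear_combination (-4 : ZMod p) * hw2⟩

/-- The number of matrices in `ℤ/p^k [R]`, `R = matR`, with the characteristic polynomial of `α`. -/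
theorem card_commuting_matR_primePow (hk : k ≠ 0)
    (hr : ∀ r : ZMod p, r ^ 2 - u * r + v ≠ 0) :
    Nat.card {s : ZMod (p ^ k) // 3 * s ^ 2 - 3 * u * s + u ^ 2 - v = 0} =
      if p % 3 = 2 then 2 else 0 := by
  have e1 : Nat.card {s : ZMod (p ^ k) // 3 * s ^ 2 - 3 * u * s + u ^ 2 - v = 0} =
      Nat.card {s : ZMod (p ^ k) // ((3 : ℤ) : ZMod (p ^ k)) * s ^ 2 + ((-3 * u : ℤ) : ZMod (p ^ k))
        * s + ((u ^ 2 - v : ℤ) : ZMod (p ^ k)) = 0} :=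
    Nat.card_congr (Equiv.subtypeEquivRight fun x => by push_cast; ring_nf)
  have hpp : p.Prime := Fact.out
  rw [e1]
  by_cases hp : p = 2
  · subst hp
    obtain ⟨hu, hv⟩ := intCast_eq_one_of_two hr
    have h2 : (2 : ZMod 2) = 0 := rfl
    rw [card_quadratic_roots_eq (reduction 2 hk) (reduction_surjective hk)
      (isNilpotent_of_reduction_eq_zero hk)]
    · rw [Nat.card_congr (Equiv.subtypeUnivEquiv fun r => ?_), Nat.card_zmod, if_pos rfl]
      simp only [map_intCast]
      push_cast
      rw [hu, hv]
      linear_combination zmod_two_sq_add_self r + (r ^ 2 - 2 * r) * h2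
    · intro r _ h
      simp only [map_intCast] at h
      push_cast at h
      rw [hu] at h
      exact one_ne_zero (α := ZMod 2) (by linear_combination h + (2 - 3 * r) * h2)
  by_cases hp3 : p = 3
  · subst hp3
    rw [if_neg (by norm_num), Nat.card_eq_zero]
    left
    -- Modulo 3 the equation degenerates to u² - v = 0, and u² - v is the discriminant u² - 4v
    -- there.
    refine ⟨fun ⟨x, hx⟩ => disc_ne_zero hp hr ?_⟩
    have h3 : (3 : ZMod 3) = 0 := rfl
    have := congrArg (reduction 3 hk) hx
    simp only [map_add, map_mul, map_pow, map_intCast, map_zero] at this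
    push_cast at this ⊢
    generalize reduction 3 hk x = y at this
    linear_combination this + (-y ^ 2 + u * y - v) * h3
  · have h3 : ((3 : ℤ) : ZMod p) ≠ 0 := by
      intro h
      have : ((3 : ℕ) : ZMod p) = 0 := by exact_mod_cast h
      rw [ZMod.natCast_eq_zero_iff] at this
      exact hp3 ((Nat.prime_dvd_prime_iff_eq hpp Nat.prime_three).1 this)
    have hD : (-3 * u) ^ 2 - 4 * 3 * (u ^ 2 - v) = -3 * (u ^ 2 - 4 * v) := by ring
    have h3' : ((-3 : ℤ) : ZMod p) ≠ 0 := by rw [Int.cast_neg]; exact neg_ne_zero.2 h3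
    have key := card_quadratic_roots_primePow hk hp 3 (-3 * u) (u ^ 2 - v) h3 (by
      rw [hD, Int.cast_mul]
      exact mul_ne_zero h3' (disc_ne_zero hp hr))
    rw [hD, legendreSym.mul, legendreSym_disc hp hr] at key
    have hsq := isSquare_neg_three_iff hp hp3
    have h3m : p % 3 ≠ 0 := fun h =>
      hp3 ((Nat.prime_dvd_prime_iff_eq Nat.prime_three hpp).1 (Nat.dvd_of_mod_eq_zero h)).symm
    split_ifs with h
    · have : legendreSym p (-3) = -1 := by
        rw [legendreSym.eq_neg_one_iff]
        push_cast
        rw [hsq]; omega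
      rw [this] at key
      exact Nat.cast_injective (R := ℤ) (key.trans (by norm_num))
    · have : legendreSym p (-3) = 1 := by
        rw [legendreSym.eq_one_iff p h3']
        push_cast
        rw [hsq]; omega
      rw [this] at key
      exact Nat.cast_injective (R := ℤ) (key.trans (by norm_num))

/-! ### Surjectivity of the norm -/

/-- For p odd, with x = 2a + ub and y = b, the equation reads x² - (u² - 4v)y² = 4c, which is
solvable by the pigeonhole count for sums of two quadratics. -/
theorem exists_norm_eq_of_prime (hr : ∀ r : ZMod p, r ^ 2 - u * r + v ≠ 0) (c : ZMod p)
    (hc : c ≠ 0) : ∃ a b : ZMod p, a ^ 2 + u * a * b + v * b ^ 2 = c := by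
  by_cases hp : p = 2
  · subst hp
    refine ⟨1, 0, ?_⟩
    rw [zmod_two_eq_one hc]
    ring
  · have h2 := two_ne_zero_of_odd hp
    have h4 : (4 : ZMod p) ≠ 0 := by
      rw [show (4 : ZMod p) = 2 * 2 by norm_num]; exact mul_ne_zero h2 h2
    have hD := disc_ne_zero hp hr
    push_cast at hD
    obtain ⟨x, y, hxy⟩ := FiniteField.exists_root_sum_quadratic
      (f := Polynomial.X ^ 2 - Polynomial.C (4 * c))
      (g := Polynomial.C (-(u ^ 2 - 4 * v) : ZMod p) * Polynomial.X ^ 2)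
      (Polynomial.degree_X_pow_sub_C (by norm_num) _)
      (Polynomial.degree_C_mul_X_pow 2 (neg_ne_zero.2 hD))
      (by rw [ZMod.card]; exact (Fact.out : p.Prime).eq_two_or_odd.resolve_left hp)
    simp only [Polynomial.eval_sub, Polynomial.eval_pow, Polynomial.eval_X, Polynomial.eval_C,
      Polynomial.eval_mul] at hxy
    refine ⟨(x - u * y) / 2, y, ?_⟩
    have hz : 2 * ((x - u * y) / 2) = x - u * y := by field_simp
    apply mul_left_cancel₀ h4
    set z := (x - u * y) / 2
    linear_combination (2 * z + x + u * y) * hz + hxy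

/-- One coordinate of a solution modulo p is frozen and the other lifted by Hensel. This needs one
partial derivative of the norm form to be nonzero. For p odd, Euler's identity a∂ₐ + b∂_b = 2c rules
out that both vanish; for p = 2 the gradient is (b, a), nonzero because c is. -/
theorem exists_norm_eq_primePow (hk : k ≠ 0) (hr : ∀ r : ZMod p, r ^ 2 - u * r + v ≠ 0)
    (c : ZMod (p ^ k)) (hc : IsUnit c) :
    ∃ a b : ZMod (p ^ k), a ^ 2 + u * a * b + v * b ^ 2 = c := by
  have hs := reduction_surjective (p := p) hk
  have hn := isNilpotent_of_reduction_eq_zero (p := p) hk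
  obtain ⟨a, b, hab⟩ := exists_norm_eq_of_prime hr _ ((isUnit_iff_reduction_ne_zero hk c).1 hc)
  obtain ⟨a, rfl⟩ := hs a
  obtain ⟨b, rfl⟩ := hs b
  by_cases ha : 2 * reduction p hk a + u * reduction p hk b = 0
  · obtain ⟨y, ⟨hy, -⟩, -⟩ := existsUnique_lift_quadratic_root (reduction p hk) hs hn v (u * a)
      (a ^ 2 - c) (reduction p hk b) (by simp; linear_combination hab) (by
        simp only [map_intCast, map_mul]
        intro hb
        have hc0 := (isUnit_iff_reduction_ne_zero hk c).1 hc
        rw [← hab] at hc0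
        by_cases hp : p = 2
        · subst hp
          obtain ⟨hu, hv⟩ := intCast_eq_one_of_two hr
          have h2 : (2 : ZMod 2) = 0 := rfl
          rw [hu, h2] at ha
          rw [hv, hu, h2] at hb
          have hb0 : reduction 2 hk b = 0 := by linear_combination ha
          have ha0 : reduction 2 hk a = 0 := by linear_combination hb
          rw [ha0, hb0] at hc0
          simp at hc0
        · refine mul_ne_zero (two_ne_zero_of_odd hp) hc0 ?_
          linear_combination reduction p hk a * ha + reduction p hk b * hb)
    exact ⟨a, y, by linear_combination hy⟩
  · obtain ⟨y, ⟨hy, -⟩, -⟩ := existsUnique_lift_quadratic_root (reduction p hk) hs hn 1 (u * b)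
      (v * b ^ 2 - c) (reduction p hk a) (by simp; linear_combination hab) (by
        simpa [map_mul] using ha)
    exact ⟨y, b, by linear_combination hy⟩

end PrimePower

/-! ### Conics `x² + y² = d` over `ℤ/p^k` -/

section Conic

variable {p k : ℕ} [Fact p.Prime]

theorem card_units_primePow (hk : k ≠ 0) :
    Nat.card (ZMod (p ^ k))ˣ = p ^ (k - 1) * (p - 1) := by
  have : NeZero (p ^ k) := ⟨pow_ne_zero _ (Fact.out : p.Prime).ne_zero⟩
  rw [Nat.card_eq_fintype_card, ZMod.card_units_eq_totient,
    Nat.totient_prime_pow Fact.out (Nat.pos_of_ne_zero hk)]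

/-- A square root i of -1 lifts to ℤ/p^k, and x² + y² = (x + iy)(x - iy), so x + iy can be any unit
and determines the point. -/
theorem card_conic_of_mod_four_eq_one (hk : k ≠ 0) (hp : p % 4 = 1) (d : ZMod (p ^ k))
    (hd : IsUnit d) :
    Nat.card {z : ZMod (p ^ k) × ZMod (p ^ k) // z.1 ^ 2 + z.2 ^ 2 = d} =
      p ^ (k - 1) * (p - 1) := by
  have hp2 : p ≠ 2 := by omega
  have h2' := two_ne_zero_of_odd hp2
  have hs := reduction_surjective (p := p) hk
  have hn := isNilpotent_of_reduction_eq_zero (p := p) hk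
  obtain ⟨j, hj⟩ := (ZMod.exists_sq_eq_neg_one_iff (p := p)).2 (by omega)
  obtain ⟨i, ⟨hi, -⟩, -⟩ := existsUnique_lift_quadratic_root (reduction p hk) hs hn 1 0 1 j
    (by simp; linear_combination -hj) (by
      simp only [map_one, map_zero, add_zero, mul_one]
      refine mul_ne_zero h2' ?_
      rintro rfl
      simp at hj)
  have h2 : IsUnit (2 : ZMod (p ^ k)) := by
    rw [isUnit_iff_reduction_ne_zero hk, map_ofNat]; exact h2'
  obtain ⟨h, hh⟩ := h2.exists_right_inv
  rw [← card_units_primePow hk]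
  refine Nat.card_congr (Equiv.ofBijective (fun z => IsUnit.unit
    (a := z.1.1 + i * z.1.2) ?_) ⟨?_, ?_⟩)
  · refine isUnit_of_mul_isUnit_left (y := z.1.1 - i * z.1.2) ?_
    have : (z.1.1 + i * z.1.2) * (z.1.1 - i * z.1.2) = d := by
      linear_combination z.2 - z.1.2 ^ 2 * hi
    rwa [this]
  · rintro ⟨⟨x, y⟩, hz⟩ ⟨⟨x', y'⟩, hz'⟩ hzz
    have e1 : x + i * y = x' + i * y' := congrArg Units.val hzz
    simp only at hz hz'
    have hu : IsUnit (x + i * y) := by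
      refine isUnit_of_mul_isUnit_left (y := x - i * y) ?_
      have : (x + i * y) * (x - i * y) = d := by linear_combination hz - y ^ 2 * hi
      rwa [this]
    have e2 : x - i * y = x' - i * y' := by
      apply hu.mul_left_cancel
      linear_combination hz - hz' - y ^ 2 * hi + y' ^ 2 * hi - (x' - i * y') * e1
    have ex : x = x' := by
      apply h2.mul_left_cancel; linear_combination e1 + e2
    have ey : y = y' := by
      apply h2.mul_left_cancel; linear_combination -i * (e1 - e2) + 2 * (y - y') * hi
    subst ex ey
    rfl
  · intro w
    -- The solution of x + iy = w, x - iy = d/w, with h = 1/2 and 1/i = -i.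
    refine ⟨⟨(h * (w + d * (w⁻¹ : (ZMod (p ^ k))ˣ)), -i * h * (w - d * (w⁻¹ : (ZMod (p ^ k))ˣ))),
      ?_⟩, Units.ext ?_⟩
    · have hw : (w : ZMod (p ^ k)) * (w⁻¹ : (ZMod (p ^ k))ˣ) = 1 := w.mul_inv
      simp only
      generalize ((w⁻¹ : (ZMod (p ^ k))ˣ) : ZMod (p ^ k)) = w' at *
      generalize (w : ZMod (p ^ k)) = w at *
      linear_combination 4 * h ^ 2 * d * hw + d * (2 * h + 1) * hh +
        (h * (w - d * w')) ^ 2 * hi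
    · simp only [IsUnit.unit_spec]
      generalize ((w⁻¹ : (ZMod (p ^ k))ˣ) : ZMod (p ^ k)) = w' at *
      generalize (w : ZMod (p ^ k)) = w at *
      linear_combination w * hh - h * (w - d * w') * hi

theorem card_nonunits_primePow (hk : k ≠ 0) :
    Nat.card {x : ZMod (p ^ k) // ¬ IsUnit x} = p ^ (k - 1) := by
  have : NeZero (p ^ k) := ⟨pow_ne_zero _ (Fact.out : p.Prime).ne_zero⟩
  have h1 : Nat.card {x : ZMod (p ^ k) // IsUnit x} = p ^ (k - 1) * (p - 1) := by
    rw [← card_units_primePow hk]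
    exact Nat.card_congr (Equiv.ofBijective (fun x => x.2.unit) ⟨fun x y h =>
      Subtype.ext (congrArg Units.val h), fun w => ⟨⟨w, w.isUnit⟩, Units.ext rfl⟩⟩)
  have h2 : Nat.card (ZMod (p ^ k)) = Nat.card {x : ZMod (p ^ k) // IsUnit x} +
      Nat.card {x : ZMod (p ^ k) // ¬ IsUnit x} := by
    classical
    rw [← Nat.card_sum]
    exact Nat.card_congr (Equiv.sumCompl _).symm
  rw [h1, Nat.card_zmod] at h2
  obtain ⟨k, rfl⟩ := Nat.exists_eq_succ_of_ne_zero hk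
  obtain ⟨m, rfl⟩ : ∃ m, p = m + 1 := ⟨p - 1, by have := (Fact.out : p.Prime).pos; omega⟩
  simp only [Nat.succ_eq_add_one, Nat.add_sub_cancel] at *
  rw [pow_succ] at h2
  exact (Nat.add_left_cancel (h2.symm.trans (by ring : _ = (m + 1) ^ k * m + (m + 1) ^ k)))

/-- Here x² + y² is the norm form of ℤ/p^k[i] with p inert. All unit values are taken equally often,
say n times, and the value is a nonunit only if x and y both are. Counting all pairs gives p^(2k) =
p^(k-1)(p - 1)n + p^(2k-2). -/
theorem card_conic_of_mod_four_eq_three (hk : k ≠ 0) (hp : p % 4 = 3) (d : ZMod (p ^ k))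
    (hd : IsUnit d) :
    Nat.card {z : ZMod (p ^ k) × ZMod (p ^ k) // z.1 ^ 2 + z.2 ^ 2 = d} =
      p ^ (k - 1) * (p + 1) := by
  have : NeZero (p ^ k) := ⟨pow_ne_zero _ (Fact.out : p.Prime).ne_zero⟩
  have hnr : ∀ r : ZMod p, r ^ 2 - ((0 : ℤ) : ZMod p) * r + ((1 : ℤ) : ZMod p) ≠ 0 := by
    intro r h
    have : IsSquare (-1 : ZMod p) := ⟨r, by push_cast at h; linear_combination -h⟩
    rw [ZMod.exists_sq_eq_neg_one_iff] at this
    exact this hp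
  have hex : ∀ c : ZMod (p ^ k), IsUnit c → ∃ x y : ZMod (p ^ k), x ^ 2 + y ^ 2 = c := by
    intro c hc
    obtain ⟨a, b, hab⟩ := exists_norm_eq_primePow (u := 0) (v := 1) hk hnr c hc
    exact ⟨a, b, by push_cast at hab; linear_combination hab⟩
  have hfib : ∀ c : ZMod (p ^ k), IsUnit c →
      Nat.card {z : ZMod (p ^ k) × ZMod (p ^ k) // z.1 ^ 2 + z.2 ^ 2 = c} =
      Nat.card {z : ZMod (p ^ k) × ZMod (p ^ k) // z.1 ^ 2 + z.2 ^ 2 = 1} := by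
    intro c hc
    obtain ⟨x, y, hxy⟩ := hex c hc
    obtain ⟨c', hcc⟩ := hc.exists_right_inv
    -- Division and multiplication by x + iy, an element of norm c.
    refine Nat.card_congr ⟨fun z => ⟨(c' * (x * z.1.1 + y * z.1.2), c' * (x * z.1.2 - y * z.1.1)),
      ?_⟩, fun z => ⟨(x * z.1.1 - y * z.1.2, x * z.1.2 + y * z.1.1), ?_⟩, ?_, ?_⟩
    · have := z.2
      simp only
      linear_combination c' ^ 2 * c * this + c' ^ 2 * (z.1.1 ^ 2 + z.1.2 ^ 2) * hxy +
        (c * c' + 1) * hcc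
    · have := z.2
      simp only
      linear_combination c * this + (z.1.1 ^ 2 + z.1.2 ^ 2) * hxy
    · rintro ⟨⟨a, b⟩, h⟩
      refine Subtype.ext (Prod.ext ?_ ?_) <;> simp only
      · linear_combination c' * a * hxy + a * hcc
      · linear_combination c' * b * hxy + b * hcc
    · rintro ⟨⟨a, b⟩, h⟩
      refine Subtype.ext (Prod.ext ?_ ?_) <;> simp only
      · linear_combination c' * a * hxy + a * hcc
      · linear_combination c' * b * hxy + b * hcc
  have hunit : ∀ z : ZMod (p ^ k) × ZMod (p ^ k), ¬ IsUnit (z.1 ^ 2 + z.2 ^ 2) ↔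
      ¬ IsUnit z.1 ∧ ¬ IsUnit z.2 := by
    intro z
    simp only [isUnit_iff_reduction_ne_zero hk, not_not, map_add, map_pow]
    refine ⟨fun h => ?_, fun h => by rw [h.1, h.2]; simp⟩
    generalize reduction p hk z.1 = x at *
    generalize reduction p hk z.2 = y at *
    have hy : y = 0 := by
      by_contra hy
      exact ZMod.mod_four_ne_three_of_sq_eq_neg_sq' hy (x := x) (by linear_combination h) hp
    subst hy
    simpa using h
  have hA : Nat.card {z : ZMod (p ^ k) × ZMod (p ^ k) // ¬ IsUnit (z.1 ^ 2 + z.2 ^ 2)} =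
      p ^ (k - 1) * p ^ (k - 1) := by
    rw [← card_nonunits_primePow hk, ← Nat.card_prod]
    exact Nat.card_congr ((Equiv.subtypeEquivRight hunit).trans
      (Equiv.subtypeProdEquivProd (p := fun x => ¬ IsUnit x) (q := fun x => ¬ IsUnit x)))
  have hB : Nat.card {z : ZMod (p ^ k) × ZMod (p ^ k) // IsUnit (z.1 ^ 2 + z.2 ^ 2)} =
      p ^ (k - 1) * (p - 1) *
      Nat.card {z : ZMod (p ^ k) × ZMod (p ^ k) // z.1 ^ 2 + z.2 ^ 2 = 1} := by
    have e : {z : ZMod (p ^ k) × ZMod (p ^ k) // IsUnit (z.1 ^ 2 + z.2 ^ 2)} ≃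
        Σ c : (ZMod (p ^ k))ˣ, {z : ZMod (p ^ k) × ZMod (p ^ k) // z.1 ^ 2 + z.2 ^ 2 = c} :=
      ⟨fun z => ⟨z.2.unit, ⟨z.1, rfl⟩⟩, fun z => ⟨z.2.1, by rw [z.2.2]; exact z.1.isUnit⟩,
        fun z => rfl, fun ⟨c, z, hz⟩ => Sigma.ext (Units.ext hz)
          ((Subtype.heq_iff_coe_eq fun w => by simp only [IsUnit.unit_spec, hz]).2 rfl)⟩
    rw [Nat.card_congr e, Nat.card_sigma, Finset.sum_congr rfl fun (c : (ZMod (p ^ k))ˣ) _ => hfib c c.isUnit,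
      Finset.sum_const, Finset.card_univ, ← Nat.card_eq_fintype_card, card_units_primePow hk,
      smul_eq_mul]
  have hC : Nat.card (ZMod (p ^ k) × ZMod (p ^ k)) =
      Nat.card {z : ZMod (p ^ k) × ZMod (p ^ k) // IsUnit (z.1 ^ 2 + z.2 ^ 2)} +
      Nat.card {z : ZMod (p ^ k) × ZMod (p ^ k) // ¬ IsUnit (z.1 ^ 2 + z.2 ^ 2)} := by
    classical
    rw [← Nat.card_sum]
    exact Nat.card_congr (Equiv.sumCompl _).symm
  rw [hA, hB, Nat.card_prod, Nat.card_zmod] at hC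
  rw [hfib d hd]
  generalize Nat.card {z : ZMod (p ^ k) × ZMod (p ^ k) // z.1 ^ 2 + z.2 ^ 2 = 1} = n at hC ⊢
  have hpos := (Fact.out : p.Prime).two_le
  have hq : 0 < p ^ (k - 1) := pow_pos (by omega) _
  have hpk : p ^ k = p ^ (k - 1) * p := by
    rw [← pow_succ, Nat.sub_add_cancel (Nat.pos_of_ne_zero hk)]
  rw [hpk] at hC
  generalize p ^ (k - 1) = q at hC hq ⊢
  obtain ⟨m, hm⟩ : ∃ m, p = m + 2 := ⟨p - 2, by omega⟩
  rw [show p - 1 = m + 1 by omega, hm] at hC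
  rw [hm]
  refine Nat.eq_of_mul_eq_mul_left (show 0 < q * (m + 1) by positivity) ?_
  linarith

end Conic

/-! ### Multiplicativity of numbers of solutions -/

theorem eq_iff_of_prodEquiv {R S T : Type*} [CommRing R] [CommRing S] [CommRing T]
    (φ : R ≃+* S × T) (a b : R) : a = b ↔ (φ a).1 = (φ b).1 ∧ (φ a).2 = (φ b).2 := by
  rw [← Prod.ext_iff, φ.injective.eq_iff]

section Multiplicative

variable {n : ℕ} (P : ∀ (R : Type) [CommRing R], (Fin n → R) → Prop)

theorem card_solutions_mul
    (hP : ∀ (R S T : Type) [CommRing R] [CommRing S] [CommRing T] (φ : R ≃+* S × T)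
      (x : Fin n → R), P R x ↔ P S (fun i => (φ (x i)).1) ∧ P T (fun i => (φ (x i)).2))
    {a b : ℕ} (hab : a.Coprime b) :
    Nat.card {x // P (ZMod (a * b)) x} =
      Nat.card {x // P (ZMod a) x} * Nat.card {x // P (ZMod b) x} := by
  let φ := ZMod.chineseRemainder hab
  rw [← Nat.card_prod]
  refine Nat.card_congr (Equiv.trans ?_ (Equiv.subtypeProdEquivProd
    (p := P (ZMod a)) (q := P (ZMod b))))
  exact Equiv.subtypeEquiv ((Equiv.piCongrRight fun _ => φ.toEquiv).trans
    (Equiv.arrowProdEquivProdArrow (Fin n) (fun _ => ZMod a) fun _ => ZMod b)) fun x => hP _ _ _ φ x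

/-- The condition is an arbitrary predicate, uniform in the ring and compatible with products,
rather than a system of equations; this admits the existential condition of `card_signs`. -/
theorem card_solutions
    (hP : ∀ (R S T : Type) [CommRing R] [CommRing S] [CommRing T] (φ : R ≃+* S × T)
      (x : Fin n → R), P R x ↔ P S (fun i => (φ (x i)).1) ∧ P T (fun i => (φ (x i)).2))
    (h1 : ∀ x, P (ZMod 1) x) {N : ℕ} (hN : N ≠ 0) :
    Nat.card {x // P (ZMod N) x} =
      ∏ p ∈ N.primeFactors, Nat.card {x // P (ZMod (p ^ N.factorization p)) x} := by
  rw [Nat.multiplicative_factorization (fun m => Nat.card {x // P (ZMod m) x})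
    (fun _ _ h => card_solutions_mul P hP h) ?_ hN, Nat.prod_factorization_eq_prod_primeFactors]
  rw [Nat.card_congr (Equiv.subtypeUnivEquiv h1)]
  simp

end Multiplicative

/-! ### Global counts of idempotents, signs and matrices commuting with `matR` -/

theorem card_subtype_fin_one {R : Type*} (Q : R → Prop) :
    Nat.card {x : Fin 1 → R // Q (x 0)} = Nat.card {x : R // Q x} :=
  Nat.card_congr (Equiv.subtypeEquiv (Equiv.funUnique (Fin 1) R) fun _ => Iff.rfl)

theorem prod_primeFactors_congr {M : Type*} [CommMonoid M] {N : ℕ} {f : ℕ → M} {g : ℕ → M}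
    (h : ∀ p : ℕ, Fact p.Prime → p ∣ N → N.factorization p ≠ 0 → f p = g p) :
    ∏ p ∈ N.primeFactors, f p = ∏ p ∈ N.primeFactors, g p :=
  Finset.prod_congr rfl fun p hp => by
    refine h p ⟨Nat.prime_of_mem_primeFactors hp⟩ (Nat.dvd_of_mem_primeFactors hp) ?_
    rwa [← Finsupp.mem_support_iff, Nat.support_factorization]

theorem card_idempotents {N : ℕ} (hN : N ≠ 0) :
    Nat.card {e : ZMod N // e * e = e} = 2 ^ N.primeFactors.card := by
  rw [← card_subtype_fin_one, card_solutions (n := 1) (fun R _ x => x 0 * x 0 = x 0) ?_ ?_ hN,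
    ← Finset.prod_const]
  · refine prod_primeFactors_congr fun p hp _ hk => ?_
    rw [card_subtype_fin_one fun x : ZMod (p ^ N.factorization p) => x * x = x]
    exact card_idempotents_primePow hk
  · intro R S T _ _ _ φ x
    simp only [eq_iff_of_prodEquiv φ, map_mul, Prod.fst_mul, Prod.snd_mul]
  · intro x
    exact Subsingleton.elim _ _

/-- The number of elements of `ℤ/N` that are `±1` modulo each prime power. -/
theorem card_signs {N : ℕ} (hN : N ≠ 0) :
    Nat.card {s : ZMod N // ∃ e, e * e = e ∧ s = 1 - 2 * e} =
      if 2 ∣ N ∧ ¬ 2 ^ 2 ∣ N then 2 ^ (N.primeFactors.card - 1) else 2 ^ N.primeFactors.card := by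
  have key : Nat.card {s : ZMod N // ∃ e, e * e = e ∧ s = 1 - 2 * e} =
      ∏ p ∈ N.primeFactors, if p ^ N.factorization p = 2 then 1 else 2 := by
    rw [← card_subtype_fin_one,
      card_solutions (n := 1) (fun R _ x => ∃ e, e * e = e ∧ x 0 = 1 - 2 * e) ?_ ?_ hN]
    · refine prod_primeFactors_congr fun p hp _ hk => ?_
      rw [card_subtype_fin_one fun x : ZMod (p ^ N.factorization p) =>
        ∃ e, e * e = e ∧ x = 1 - 2 * e]
      generalize N.factorization p = k at hk
      have hset : {s : ZMod (p ^ k) | ∃ e, e * e = e ∧ s = 1 - 2 * e} = {1, -1} := by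
        ext s
        simp only [Set.mem_ofPred_eq, Set.mem_insert_iff, Set.mem_singleton_iff]
        constructor
        · rintro ⟨e, he, rfl⟩
          rcases idempotent_primePow hk he with rfl | rfl
          · left; ring
          · right; ring
        · rintro (rfl | rfl)
          · exact ⟨0, by ring, by ring⟩
          · exact ⟨1, by ring, by ring⟩
      change Nat.card {s : ZMod (p ^ k) | ∃ e, e * e = e ∧ s = 1 - 2 * e} = _
      rw [hset, Nat.card_coe_set_eq]
      -- The two signs collapse to one only modulo 2, the source of the exceptional case for cusps.
      have h2 : (1 : ZMod (p ^ k)) = -1 ↔ p ^ k = 2 := by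
        have : (1 : ZMod (p ^ k)) = -1 ↔ ((2 : ℕ) : ZMod (p ^ k)) = 0 := by
          push_cast
          constructor
          · intro h; linear_combination h
          · intro h; linear_combination h
        rw [this, ZMod.natCast_eq_zero_iff, Nat.dvd_prime Nat.prime_two, or_iff_right]
        intro h
        exact absurd h (Nat.one_lt_pow hk hp.out.one_lt).ne'
      split_ifs with h
      · rw [← h2.2 h, Set.pair_eq_singleton, Set.ncard_singleton]
      · exact Set.ncard_pair fun h' => h (h2.1 h')
    · intro R S T _ _ _ φ x
      constructor
      · rintro ⟨e, he, hx⟩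
        refine ⟨⟨(φ e).1, ?_, ?_⟩, ⟨(φ e).2, ?_, ?_⟩⟩
        · rw [← Prod.fst_mul, ← map_mul, he]
        · simp [hx, map_ofNat]
        · rw [← Prod.snd_mul, ← map_mul, he]
        · simp [hx, map_ofNat]
      · rintro ⟨⟨e, he, hx⟩, ⟨f, hf, hy⟩⟩
        refine ⟨φ.symm (e, f), ?_, ?_⟩
        · rw [← map_mul, Prod.mk_mul_mk, he, hf]
        · apply φ.injective
          ext
          · simpa [map_ofNat] using hx
          · simpa [map_ofNat] using hy
    · intro x
      exact ⟨0, Subsingleton.elim _ _, Subsingleton.elim _ _⟩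
  rw [key]
  have hiff : ∀ p ∈ N.primeFactors, (p ^ N.factorization p = 2 ↔ (p = 2 ∧ ¬ 2 ^ 2 ∣ N)) := by
    intro p hp
    have hpp := Nat.prime_of_mem_primeFactors hp
    have hk : N.factorization p ≠ 0 := by
      rwa [← Finsupp.mem_support_iff, Nat.support_factorization]
    have hdvd : ¬ 2 ^ 2 ∣ N ↔ N.factorization 2 < 2 := by
      rw [Nat.prime_two.pow_dvd_iff_le_factorization hN, not_le]
    rw [hdvd]
    constructor
    · intro h
      have h2 : p = 2 := (Nat.prime_dvd_prime_iff_eq hpp Nat.prime_two).1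
        (h ▸ dvd_pow_self p hk)
      subst h2
      refine ⟨rfl, ?_⟩
      have : N.factorization 2 = 1 := Nat.pow_right_injective le_rfl (by simpa using h)
      omega
    · rintro ⟨rfl, h⟩
      rw [show N.factorization 2 = 1 by omega, pow_one]
  rw [Finset.prod_congr rfl fun p hp => by rw [if_congr (hiff p hp) rfl rfl]]
  split_ifs with h
  · have h2 : 2 ∈ N.primeFactors := Nat.mem_primeFactors.2 ⟨Nat.prime_two, h.1, hN⟩
    rw [← Finset.mul_prod_erase _ _ h2, if_pos ⟨rfl, h.2⟩, one_mul, ← Finset.card_erase_of_mem h2,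
      ← Finset.prod_const]
    exact Finset.prod_congr rfl fun p hp => if_neg fun h' => (Finset.ne_of_mem_erase hp) h'.1
  · rw [← Finset.prod_const]
    refine Finset.prod_congr rfl fun p hp => if_neg ?_
    rintro ⟨rfl, h'⟩
    exact h ⟨Nat.dvd_of_mem_primeFactors hp, h'⟩

theorem card_commuting_matR {N : ℕ} (hN : N ≠ 0) {u v : ℤ}
    (hr : ∀ p : ℕ, p.Prime → p ∣ N → ∀ r : ZMod p, r ^ 2 - u * r + v ≠ 0) :
    Nat.card {s : ZMod N // 3 * s ^ 2 - 3 * u * s + u ^ 2 - v = 0} =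
      ∏ p ∈ N.primeFactors, if p % 3 = 2 then 2 else 0 := by
  rw [← card_subtype_fin_one]
  refine (card_solutions (n := 1)
    (fun R _ x => 3 * x 0 ^ 2 - 3 * u * x 0 + u ^ 2 - v = 0) ?_ ?_ hN).trans ?_
  · intro R S T _ _ _ φ x
    simp only [eq_iff_of_prodEquiv φ, map_sub, map_add, map_mul, map_pow, map_ofNat, map_intCast,
      map_zero]
    rfl
  · intro x
    exact Subsingleton.elim _ _
  · refine prod_primeFactors_congr fun p hp hpN hk => ?_
    rw [card_subtype_fin_one fun x : ZMod (p ^ N.factorization p) =>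
      3 * x ^ 2 - 3 * u * x + u ^ 2 - v = 0]
    exact card_commuting_matR_primePow hk (hr p hp.out hpN)

/-! ### Matrices conjugated by `matS` into a twist of themselves -/

section PrimePower

variable {p k : ℕ} [Fact p.Prime] {u v : ℤ}

/-- The case e = 1: S⁻¹XS = u - X forces X = (a, b; b, u - a). For p odd, completing the square
gives (2a - u)² + (2b)² = u² - 4v. For p = 2, the equation in a for fixed b reduces to a² + a + b² +
1 = 0, with two simple roots if b is a unit and none otherwise. -/
theorem card_anticommuting_matS_primePow (hk : k ≠ 0)
    (hr : ∀ r : ZMod p, r ^ 2 - u * r + v ≠ 0) :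
    Nat.card {z : ZMod (p ^ k) × ZMod (p ^ k) // z.1 * (u - z.1) - z.2 ^ 2 = v} =
      if p = 2 then 2 ^ k else if p % 4 = 1 then p ^ (k - 1) * (p - 1)
        else p ^ (k - 1) * (p + 1) := by
  split_ifs with hp hp4
  · subst hp
    obtain ⟨hu, hv⟩ := intCast_eq_one_of_two hr
    have h2 : (2 : ZMod 2) = 0 := rfl
    have e : {z : ZMod (2 ^ k) × ZMod (2 ^ k) // z.1 * (u - z.1) - z.2 ^ 2 = v} ≃
        Σ b : ZMod (2 ^ k), {a : ZMod (2 ^ k) // 1 * a ^ 2 + (-u) * a + (b ^ 2 + v) = 0} :=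
      ⟨fun z => ⟨z.1.2, z.1.1, by linear_combination -z.2⟩,
        fun z => ⟨(z.2.1, z.1), by linear_combination -z.2.2⟩, fun _ => rfl, fun _ => rfl⟩
    have hfib : ∀ b : ZMod (2 ^ k),
        Nat.card {a : ZMod (2 ^ k) // 1 * a ^ 2 + (-u) * a + (b ^ 2 + v) = 0} =
        if IsUnit b then 2 else 0 := by
      intro b
      rw [card_quadratic_roots_eq (reduction 2 hk) (reduction_surjective hk)
        (isNilpotent_of_reduction_eq_zero hk)]
      · split_ifs with hb
        · rw [Nat.card_congr (Equiv.subtypeUnivEquiv fun r => ?_), Nat.card_zmod]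
          have hb := zmod_two_eq_one ((isUnit_iff_reduction_ne_zero hk b).1 hb)
          simp only [map_intCast, map_neg, map_one, map_add, map_pow, hu, hv, hb]
          linear_combination zmod_two_sq_add_self r + (-r + 1) * h2
        · rw [isUnit_iff_reduction_ne_zero hk, not_not] at hb
          rw [Nat.card_eq_zero]
          left
          refine ⟨fun ⟨r, h⟩ => ?_⟩
          simp only [map_intCast, map_neg, map_one, map_add, map_pow, hu, hv, hb] at h
          exact one_ne_zero (α := ZMod 2)
            (by linear_combination h - zmod_two_sq_add_self r + r * h2)
      · intro r _ h
        simp only [map_intCast, map_neg, map_one, hu] at h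
        exact one_ne_zero (α := ZMod 2) (by linear_combination -h + r * h2)
    rw [Nat.card_congr e, Nat.card_sigma, Finset.sum_congr rfl fun b _ => hfib b,
      ← Finset.sum_filter, Finset.sum_const, smul_eq_mul, ← Fintype.card_subtype,
      ← Nat.card_eq_fintype_card]
    have h1 : Nat.card {x : ZMod (2 ^ k) // IsUnit x} = 2 ^ (k - 1) * (2 - 1) := by
      rw [← card_units_primePow hk]
      exact Nat.card_congr (Equiv.ofBijective (fun x => x.2.unit) ⟨fun x y h =>
        Subtype.ext (congrArg Units.val h), fun w => ⟨⟨w, w.isUnit⟩, Units.ext rfl⟩⟩)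
    rw [h1, Nat.add_one_sub_one, mul_one, ← pow_succ, Nat.sub_add_cancel (Nat.pos_of_ne_zero hk)]
  all_goals
    have h2 : IsUnit (2 : ZMod (p ^ k)) := by
      rw [isUnit_iff_reduction_ne_zero hk, map_ofNat]; exact two_ne_zero_of_odd hp
    have hd : IsUnit (u ^ 2 - 4 * v : ZMod (p ^ k)) := by
      rw [isUnit_iff_reduction_ne_zero hk]
      have := disc_ne_zero hp hr
      push_cast at this
      simpa only [map_sub, map_mul, map_pow, map_intCast, map_ofNat] using this
    have h4 : IsUnit (4 : ZMod (p ^ k)) := by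
      rw [show (4 : ZMod (p ^ k)) = 2 * 2 by norm_num]; exact h2.mul h2
    have e : Nat.card {z : ZMod (p ^ k) × ZMod (p ^ k) // z.1 * (u - z.1) - z.2 ^ 2 = v} =
        Nat.card {z : ZMod (p ^ k) × ZMod (p ^ k) // z.1 ^ 2 + z.2 ^ 2 = u ^ 2 - 4 * v} := by
      obtain ⟨h, hh⟩ := h2.exists_right_inv
      refine Nat.card_congr ⟨fun z => ⟨(2 * z.1.1 - u, 2 * z.1.2), ?_⟩,
        fun z => ⟨(h * (z.1.1 + u), h * z.1.2), ?_⟩, ?_, ?_⟩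
      · simp only
        linear_combination -4 * z.2
      · apply h4.mul_left_cancel
        have := z.2
        simp only
        linear_combination -z.2 +
          (2 * u * (z.1.1 + u) - (2 * h + 1) * ((z.1.1 + u) ^ 2 + z.1.2 ^ 2)) * hh
      · rintro ⟨⟨a, b⟩, hz⟩
        refine Subtype.ext (Prod.ext ?_ ?_) <;> simp only
        · linear_combination a * hh
        · linear_combination b * hh
      · rintro ⟨⟨a, b⟩, hz⟩
        refine Subtype.ext (Prod.ext ?_ ?_) <;> simp only
        · linear_combination (a + u) * hh
        · linear_combination b * hh
    rw [e]
  · exact card_conic_of_mod_four_eq_one hk hp4 _ hd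
  · have : p % 4 = 3 := by
      have := (Fact.out : p.Prime).eq_two_or_odd.resolve_left hp
      omega
    exact card_conic_of_mod_four_eq_three hk this _ hd

/-- The case e = 0: X = (a, b; -b, a), so 2a = u, impossible for p = 2 as u is then odd. For p odd
it remains to solve 4b² = -(u² - 4v); as u² - 4v is a nonresidue, this needs -1 to be one too. -/
theorem card_commuting_matS_primePow (hk : k ≠ 0)
    (hr : ∀ r : ZMod p, r ^ 2 - u * r + v ≠ 0) :
    Nat.card {z : ZMod (p ^ k) × ZMod (p ^ k) // 2 * z.1 - u = 0 ∧
        z.1 * (u - z.1) + z.2 ^ 2 = v} = if p % 4 = 3 then 2 else 0 := by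
  by_cases hp : p = 2
  · subst hp
    obtain ⟨hu, -⟩ := intCast_eq_one_of_two hr
    rw [if_neg (by norm_num), Nat.card_eq_zero]
    left
    refine ⟨fun ⟨z, hz, _⟩ => ?_⟩
    have := congrArg (reduction 2 hk) hz
    have h2 : (2 : ZMod 2) = 0 := rfl
    simp only [map_sub, map_mul, map_ofNat, map_intCast, map_zero, hu, h2] at this
    exact one_ne_zero (α := ZMod 2) (by linear_combination -this)
  have h2 : IsUnit (2 : ZMod (p ^ k)) := by
    rw [isUnit_iff_reduction_ne_zero hk, map_ofNat]; exact two_ne_zero_of_odd hp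
  have h4 : IsUnit (4 : ZMod (p ^ k)) := by
    rw [show (4 : ZMod (p ^ k)) = 2 * 2 by norm_num]; exact h2.mul h2
  have e : Nat.card {z : ZMod (p ^ k) × ZMod (p ^ k) // 2 * z.1 - u = 0 ∧
        z.1 * (u - z.1) + z.2 ^ 2 = v} =
      Nat.card {b : ZMod (p ^ k) // ((4 : ℤ) : ZMod (p ^ k)) * b ^ 2 + ((0 : ℤ) : ZMod (p ^ k)) * b
        + ((u ^ 2 - 4 * v : ℤ) : ZMod (p ^ k)) = 0} := by
    obtain ⟨h, hh⟩ := h2.exists_right_inv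
    refine Nat.card_congr ⟨fun z => ⟨z.1.2, ?_⟩, fun b => ⟨(h * u, b.1), ?_, ?_⟩, ?_, ?_⟩
    · push_cast
      linear_combination 4 * z.2.2 + (2 * z.1.1 - u) * z.2.1
    · linear_combination (u : ZMod (p ^ k)) * hh
    · have := b.2
      push_cast at this
      apply h4.mul_left_cancel
      simp only
      linear_combination this + (u ^ 2 - 2 * h * u ^ 2 : ZMod (p ^ k)) * hh
    · rintro ⟨⟨a, b⟩, hz, hz'⟩
      refine Subtype.ext (Prod.ext ?_ rfl)
      simp only at hz ⊢
      linear_combination a * hh - h * hz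
    · rintro ⟨b, hb⟩
      rfl
  rw [e]
  have hD : (0 : ℤ) ^ 2 - 4 * 4 * (u ^ 2 - 4 * v) = (-1) * (4 ^ 2 * (u ^ 2 - 4 * v)) := by ring
  have h4' : ((4 : ℤ) : ZMod p) ≠ 0 := by
    have h := (isUnit_iff_reduction_ne_zero hk _).1 h4
    rw [map_ofNat] at h
    exact_mod_cast h
  have key := card_quadratic_roots_primePow hk hp 4 0 (u ^ 2 - 4 * v) h4' (by
    rw [hD, Int.cast_mul, Int.cast_mul, Int.cast_pow]
    exact mul_ne_zero (by simp) (mul_ne_zero (pow_ne_zero _ h4') (disc_ne_zero hp hr)))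
  rw [hD, legendreSym.mul, legendreSym.mul, legendreSym.sq_one' p h4', legendreSym_disc hp hr]
    at key
  have h1 : ((-1 : ℤ) : ZMod p) ≠ 0 := by simp
  have hsq : IsSquare (((-1 : ℤ)) : ZMod p) ↔ p % 4 ≠ 3 := by
    rw [← ZMod.exists_sq_eq_neg_one_iff (p := p)]; simp
  split_ifs with h
  · rw [(legendreSym.eq_neg_one_iff p).2 (by rw [hsq, not_not]; exact h)] at key
    exact Nat.cast_injective (R := ℤ) (key.trans (by norm_num))
  · rw [(legendreSym.eq_one_iff p h1).2 (hsq.2 h)] at key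
    exact Nat.cast_injective (R := ℤ) (key.trans (by norm_num))

theorem card_twisted_matS_primePow (hk : k ≠ 0)
    (hr : ∀ r : ZMod p, r ^ 2 - u * r + v ≠ 0) :
    Nat.card {x : Fin 3 → ZMod (p ^ k) // x 2 * x 2 = x 2 ∧ (1 - x 2) * (2 * x 0 - u) = 0 ∧
        x 0 * (u - x 0) - (2 * x 2 - 1) * x 1 ^ 2 = v} =
      if p = 2 then 2 ^ k else if p % 4 = 1 then p ^ (k - 1) * (p - 1)
        else 2 + p ^ (k - 1) * (p + 1) := by
  have hpp : p.Prime := Fact.out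
  have : NeZero (p ^ k) := ⟨pow_ne_zero _ hpp.ne_zero⟩
  have : Fact (1 < p ^ k) := ⟨Nat.one_lt_pow hk hpp.one_lt⟩
  have e : {z : ZMod (p ^ k) × ZMod (p ^ k) // 2 * z.1 - u = 0 ∧
        z.1 * (u - z.1) + z.2 ^ 2 = v} ⊕
      {z : ZMod (p ^ k) × ZMod (p ^ k) // z.1 * (u - z.1) - z.2 ^ 2 = v} ≃
      {x : Fin 3 → ZMod (p ^ k) // x 2 * x 2 = x 2 ∧ (1 - x 2) * (2 * x 0 - u) = 0 ∧
        x 0 * (u - x 0) - (2 * x 2 - 1) * x 1 ^ 2 = v} := by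
    refine Equiv.ofBijective (Sum.elim
      (fun z => ⟨![z.1.1, z.1.2, 0], by simp, by simpa using z.2.1, ?_⟩)
      (fun z => ⟨![z.1.1, z.1.2, 1], by simp, by simp, ?_⟩)) ⟨?_, ?_⟩
    · have := z.2.2
      simp
      linear_combination this
    · have := z.2
      simp
      linear_combination this
    · rintro (⟨⟨a, b⟩, h⟩ | ⟨⟨a, b⟩, h⟩) (⟨⟨a', b'⟩, h'⟩ | ⟨⟨a', b'⟩, h'⟩) he
      all_goals
        have h0 := congrFun (congrArg Subtype.val he) 0
        have h1 := congrFun (congrArg Subtype.val he) 1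
        have h2 := congrFun (congrArg Subtype.val he) 2
        simp at h0 h1 h2
      all_goals
        subst h0 h1
        rfl
    · rintro ⟨x, hx1, hx2, hx3⟩
      rcases idempotent_primePow hk hx1 with h | h
      · refine ⟨Sum.inl ⟨(x 0, x 1), ?_, ?_⟩, Subtype.ext ?_⟩
        · rw [h] at hx2; linear_combination hx2
        · rw [h] at hx3; linear_combination hx3
        · ext i; fin_cases i <;> simp [h]
      · refine ⟨Sum.inr ⟨(x 0, x 1), ?_⟩, Subtype.ext ?_⟩
        · rw [h] at hx3; linear_combination hx3
        · ext i; fin_cases i <;> simp [h]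
  rw [← Nat.card_congr e, Nat.card_sum, card_commuting_matS_primePow hk hr,
    card_anticommuting_matS_primePow hk hr]
  by_cases hp : p = 2
  · subst hp; simp
  · have := hpp.eq_two_or_odd.resolve_left hp
    rw [if_neg hp, if_neg hp]
    by_cases h : p % 4 = 1
    · rw [if_pos h, if_pos h, if_neg (by omega), zero_add]
    · rw [if_neg h, if_neg h, if_pos (by omega)]

end PrimePower

theorem card_twisted_matS {N : ℕ} (hN : N ≠ 0) {u v : ℤ}
    (hr : ∀ p : ℕ, p.Prime → p ∣ N → ∀ r : ZMod p, r ^ 2 - u * r + v ≠ 0) :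
    Nat.card {x : Fin 3 → ZMod N // x 2 * x 2 = x 2 ∧ (1 - x 2) * (2 * x 0 - u) = 0 ∧
        x 0 * (u - x 0) - (2 * x 2 - 1) * x 1 ^ 2 = v} =
      ∏ p ∈ N.primeFactors, if p = 2 then 2 ^ N.factorization p
        else if p % 4 = 1 then p ^ (N.factorization p - 1) * (p - 1)
        else 2 + p ^ (N.factorization p - 1) * (p + 1) := by
  refine (card_solutions (fun R _ (x : Fin 3 → R) => x 2 * x 2 = x 2 ∧
    (1 - x 2) * (2 * x 0 - u) = 0 ∧ x 0 * (u - x 0) - (2 * x 2 - 1) * x 1 ^ 2 = v) ?_ ?_ hN).trans ?_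
  · intro R S T _ _ _ φ x
    simp only [eq_iff_of_prodEquiv φ, map_sub, map_mul, map_pow, map_ofNat, map_intCast,
      map_zero, map_one]
    constructor
    · rintro ⟨⟨h1, h2⟩, ⟨h3, h4⟩, ⟨h5, h6⟩⟩
      exact ⟨⟨h1, h3, h5⟩, ⟨h2, h4, h6⟩⟩
    · rintro ⟨⟨h1, h3, h5⟩, ⟨h2, h4, h6⟩⟩
      exact ⟨⟨h1, h2⟩, ⟨h3, h4⟩, ⟨h5, h6⟩⟩
  · intro x
    exact ⟨Subsingleton.elim _ _, Subsingleton.elim _ _, Subsingleton.elim _ _⟩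
  · exact prod_primeFactors_congr fun p hp hpN hk => card_twisted_matS_primePow hk (hr p hp.out hpN)

/-! ### Units modulo `N` -/

theorem isUnit_of_forall_prime {N : ℕ} (hN : N ≠ 0) (x : ZMod N)
    (h : ∀ (p : ℕ) (_ : p.Prime) (hp : p ∣ N), ZMod.castHom hp (ZMod p) x ≠ 0) : IsUnit x := by
  have : NeZero N := ⟨hN⟩
  obtain ⟨n, rfl⟩ := ZMod.natCast_zmod_surjective x
  rw [ZMod.isUnit_iff_coprime]
  refine Nat.coprime_of_dvd fun p hp hpn hpN => h p hp hpN ?_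
  rw [map_natCast, ZMod.natCast_eq_zero_iff]
  exact hpn

section Level

variable {N : ℕ} {u v : ℤ}

theorem isUnit_charpoly_eval (hN : N ≠ 0)
    (hr : ∀ p : ℕ, p.Prime → p ∣ N → ∀ r : ZMod p, r ^ 2 - u * r + v ≠ 0) (a : ZMod N) :
    IsUnit (a ^ 2 - u * a + v) := by
  refine isUnit_of_forall_prime hN _ fun p hp hpN => ?_
  simpa only [map_sub, map_add, map_mul, map_pow, map_intCast] using hr p hp hpN _

theorem isUnit_disc (hN : N ≠ 0)
    (hr : ∀ p : ℕ, p.Prime → p ∣ N → ∀ r : ZMod p, r ^ 2 - u * r + v ≠ 0) :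
    IsUnit (u ^ 2 - 4 * v : ZMod N) := by
  refine isUnit_of_forall_prime hN _ fun p hp hpN => ?_
  have : Fact p.Prime := ⟨hp⟩
  simp only [map_sub, map_mul, map_pow, map_intCast, map_ofNat]
  by_cases h2 : p = 2
  · subst h2
    have h4 : (4 : ZMod 2) = 0 := rfl
    rw [(intCast_eq_one_of_two (hr 2 hp hpN)).1, h4]
    simp
  · have := disc_ne_zero h2 (hr p hp hpN)
    push_cast at this
    exact this

theorem exists_norm_eq (hN : N ≠ 0)
    (hr : ∀ p : ℕ, p.Prime → p ∣ N → ∀ r : ZMod p, r ^ 2 - u * r + v ≠ 0) :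
    ∀ c : ZMod N, IsUnit c → ∃ a b : ZMod N, a ^ 2 + u * a * b + v * b ^ 2 = c := by
  induction N using Nat.recOnPosPrimePosCoprime with
  | prime_pow p k hp hk =>
    have : Fact p.Prime := ⟨hp⟩
    exact exists_norm_eq_primePow hk.ne' (hr p hp (dvd_pow_self p hk.ne'))
  | zero => exact absurd rfl hN
  | one => exact fun c _ => ⟨0, 0, Subsingleton.elim _ _⟩
  | coprime a b ha hb hab iha ihb =>
    intro c hc
    let φ := ZMod.chineseRemainder hab
    have hc' := Prod.isUnit_iff.1 (hc.map φ)
    obtain ⟨x, y, h⟩ := iha (by omega) (fun p hp h => hr p hp (h.mul_right b)) _ hc'.1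
    obtain ⟨x', y', h'⟩ := ihb (by omega) (fun p hp h => hr p hp (h.mul_left a)) _ hc'.2
    refine ⟨φ.symm (x, x'), φ.symm (y, y'), φ.injective ?_⟩
    ext
    · simpa using h
    · simpa using h'

theorem IsNonsplit.charpoly_ne_zero (huv : IsNonsplit N u v) (p : ℕ) (hp : p.Prime) (hpN : p ∣ N)
    (r : ZMod p) : r ^ 2 - u * r + v ≠ 0 := by
  intro h
  obtain ⟨n, rfl⟩ := ZMod.intCast_surjective r
  have h0 : ((n ^ 2 - u * n + v : ℤ) : ZMod p) = 0 := by push_cast; exact h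
  rw [ZMod.intCast_zmod_eq_zero_iff_dvd _ p] at h0
  obtain ⟨m, hm⟩ := h0
  have hI := huv.inert p hp hpN
  -- A root n modulo p gives (α - n)(u - n - α) = n² - un + v ∈ (p), while neither factor lies in
  -- (p), their α-coefficients being ±1.
  have hmem : (⟨-n, 1⟩ : QuadOrder u v) * ⟨u - n, -1⟩ ∈ Ideal.span {(p : QuadOrder u v)} := by
    rw [Ideal.mem_span_singleton]
    refine ⟨⟨m, 0⟩, ?_⟩
    ext
    · simp
      linear_combination hm
    · simp
  have hdvd : ∀ x y : ℤ, (⟨x, y⟩ : QuadOrder u v) ∈ Ideal.span {(p : QuadOrder u v)} →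
      (p : ℤ) ∣ y := by
    intro x y hxy
    rw [Ideal.mem_span_singleton] at hxy
    obtain ⟨z, hz⟩ := hxy
    refine ⟨z.im, ?_⟩
    have := congrArg QuadraticAlgebra.im hz
    simpa using this
  have h1 : (p : ℤ) ∣ 1 := by
    rcases hI.mem_or_mem hmem with h | h
    · exact hdvd _ _ h
    · exact (dvd_neg).1 (hdvd _ _ h)
  exact hp.one_lt.ne' (by exact_mod_cast Int.eq_one_of_dvd_one (by positivity) h1)

end Level

/-! ### Twists by idempotents -/

section Twist

variable {R : Type*} [CommRing R]

/-- The matrix of multiplication by `α` in the basis `1, α`. -/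
def alphaMatrix (R : Type*) [CommRing R] (u v : ℤ) : Matrix (Fin 2) (Fin 2) R :=
  !![0, -(v : R); 1, (u : R)]

/-- For an idempotent `e`, the matrix which is `u - X` where `e = 1` and `X` where `e = 0`. -/
def twist (u : ℤ) (e : R) (X : Matrix (Fin 2) (Fin 2) R) : Matrix (Fin 2) (Fin 2) R :=
  X + e • ((u : R) • 1 - (2 : R) • X)

/-- The matrix which is the involution `α ↦ u - α` where `e = 1` and the identity where `e = 0`. -/
def conjAt (u : ℤ) (e : R) : Matrix (Fin 2) (Fin 2) R := !![1, e * u; 0, 1 - 2 * e]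

variable {u v : ℤ} {e f : R} {g X Y : Matrix (Fin 2) (Fin 2) R}

@[simp]
theorem twist_zero : twist u 0 X = X := by simp [twist]

/-- On idempotents, e + f - 2ef is symmetric difference, so twists form an elementary abelian
2-group. -/
theorem twist_twist : twist u f (twist u e X) = twist u (e + f - 2 * e * f) X := by
  ext i j
  simp [twist]
  ring

theorem twist_self_twist (he : e * e = e) : twist u e (twist u e X) = X := by
  rw [twist_twist, show e + e - 2 * e * e = 0 by linear_combination -2 * he, twist_zero]

/-- A twist is a polynomial in the matrix with scalar coefficients, so intertwiners carry over. -/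
theorem mul_twist (h : g * X = Y * g) : g * twist u e X = twist u e Y * g := by
  simp [twist, mul_add, add_mul, mul_sub, sub_mul, h]

theorem symmDiff_idempotent (he : e * e = e) (hf : f * f = f) :
    (e + f - 2 * e * f) * (e + f - 2 * e * f) = e + f - 2 * e * f := by
  linear_combination (1 - 4 * f + 4 * f * f) * he + (1 - 2 * e + 2 * e - 4 * e + 4 * e) * hf

theorem conjAt_mul_conjAt (u : ℤ) (e f : R) :
    conjAt u e * conjAt u f = conjAt u (e + f - 2 * e * f) := by
  ext i j
  fin_cases i <;> fin_cases j <;> simp [conjAt, Matrix.mul_apply, Fin.sum_univ_two] <;> ring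

theorem conjAt_zero (u : ℤ) : conjAt u (0 : R) = 1 := by
  ext i j
  fin_cases i <;> fin_cases j <;> simp [conjAt]

theorem conjAt_one (u : ℤ) : conjAt u (1 : R) = conjMatrix R u := by
  ext i j
  fin_cases i <;> fin_cases j <;> simp [conjAt, conjMatrix]
  norm_num

theorem conjAt_map {S : Type*} [CommRing S] (φ : R →+* S) (u : ℤ) (e : R) :
    (conjAt u e).map φ = conjAt u (φ e) := by
  ext i j
  fin_cases i <;> fin_cases j <;> simp [conjAt, map_ofNat]

theorem conjAt_mul_alphaMatrix (v : ℤ) (he : e * e = e) :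
    conjAt u e * alphaMatrix R u v = twist u e (alphaMatrix R u v) * conjAt u e := by
  ext i j
  fin_cases i <;> fin_cases j <;>
    simp [conjAt, alphaMatrix, twist, Matrix.mul_apply, Fin.sum_univ_two]
  · linear_combination (4 * v - u ^ 2 : R) * he
  · ring
  · ring

/-- `conjAt` as an element of `GL₂`. -/
def conjAtGL (u : ℤ) (e : R) (he : e * e = e) : GL (Fin 2) R :=
  ⟨conjAt u e, conjAt u e, by
    rw [conjAt_mul_conjAt, show e + e - 2 * e * e = 0 by linear_combination -2 * he, conjAt_zero],
    by rw [conjAt_mul_conjAt, show e + e - 2 * e * e = 0 by linear_combination -2 * he,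
      conjAt_zero]⟩

end Twist

/-! ### The group `C_ns^*(N)` as a group of matrices permuting the twists of `α` -/

variable {N : ℕ} {u v : ℤ}

/-- The matrices conjugating `α` to one of its twists. -/
def twistedNormalizer (N : ℕ) (u v : ℤ) : Subgroup (GL (Fin 2) (ZMod N)) where
  carrier := {g | ∃ e : ZMod N, e * e = e ∧
    g.val * alphaMatrix (ZMod N) u v = twist u e (alphaMatrix (ZMod N) u v) * g.val}
  mul_mem' := by
    rintro g h ⟨e, he, hg⟩ ⟨f, hf, hh⟩
    refine ⟨e + f - 2 * e * f, symmDiff_idempotent he hf, ?_⟩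
    rw [Units.val_mul, mul_assoc, hh, ← mul_assoc, mul_twist hg, twist_twist, mul_assoc]
  one_mem' := ⟨0, by simp, by simp⟩
  inv_mem' := by
    rintro g ⟨e, he, hg⟩
    refine ⟨e, he, ?_⟩
    have h := mul_twist (u := u) (e := e) hg
    rw [twist_self_twist he] at h
    calc (g⁻¹).val * alphaMatrix (ZMod N) u v
        = (g⁻¹).val * (alphaMatrix (ZMod N) u v * g.val) * (g⁻¹).val := by
          simp [mul_assoc]
      _ = _ := by rw [← h]; simp [← mul_assoc]

theorem leftMulMatrix_eq (x : QuadMod N u v) :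
    Algebra.leftMulMatrix (QuadraticAlgebra.basis (-(v : ZMod N)) (u : ZMod N)) x =
      !![x.re, -v * x.im; x.im, x.re + u * x.im] := by
  have h0 : QuadraticAlgebra.basis (-(v : ZMod N)) (u : ZMod N) 0 = ⟨1, 0⟩ := by
    apply (QuadraticAlgebra.basis (-(v : ZMod N)) (u : ZMod N)).repr.injective
    ext i
    fin_cases i <;> simp
  have h1 : QuadraticAlgebra.basis (-(v : ZMod N)) (u : ZMod N) 1 = ⟨0, 1⟩ := by
    apply (QuadraticAlgebra.basis (-(v : ZMod N)) (u : ZMod N)).repr.injective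
    ext i
    fin_cases i <;> simp
  ext i j
  rw [Algebra.leftMulMatrix_eq_repr_mul]
  fin_cases i <;> fin_cases j <;> simp [h0, h1]

/-- The vector 1 is cyclic for α, so a matrix commuting with α is determined by its first column,
the image of 1. -/
theorem exists_eq_leftMulMatrix {X : Matrix (Fin 2) (Fin 2) (ZMod N)}
    (hX : X * alphaMatrix (ZMod N) u v = alphaMatrix (ZMod N) u v * X) :
    ∃ x : QuadMod N u v,
      Algebra.leftMulMatrix (QuadraticAlgebra.basis (-(v : ZMod N)) (u : ZMod N)) x = X := by
  have h00 := congrFun (congrFun hX 0) 0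
  have h10 := congrFun (congrFun hX 1) 0
  simp [alphaMatrix, Matrix.mul_apply, Fin.sum_univ_two] at h00 h10
  refine ⟨⟨X 0 0, X 1 0⟩, ?_⟩
  rw [leftMulMatrix_eq]
  ext i j
  fin_cases i <;> fin_cases j <;> simp [h00, h10]

theorem mem_cartan_iff (g : GL (Fin 2) (ZMod N)) : g ∈ cartan N u v ↔
    g.val * alphaMatrix (ZMod N) u v = alphaMatrix (ZMod N) u v * g.val := by
  constructor
  · rintro ⟨x, rfl⟩
    have : alphaMatrix (ZMod N) u v =
        Algebra.leftMulMatrix (QuadraticAlgebra.basis (-(v : ZMod N)) (u : ZMod N)) ⟨0, 1⟩ := by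
      rw [leftMulMatrix_eq]
      simp [alphaMatrix]
    rw [this]
    simp only [Units.coe_map, MonoidHom.coe_coe]
    rw [← map_mul, mul_comm, map_mul]
  · intro h
    have h' : (g⁻¹).val * alphaMatrix (ZMod N) u v = alphaMatrix (ZMod N) u v * (g⁻¹).val := by
      calc (g⁻¹).val * alphaMatrix (ZMod N) u v
          = (g⁻¹).val * (alphaMatrix (ZMod N) u v * g.val) * (g⁻¹).val := by
            simp [mul_assoc]
        _ = _ := by rw [← h]; simp [← mul_assoc]
    obtain ⟨x, hx⟩ := exists_eq_leftMulMatrix h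
    obtain ⟨y, hy⟩ := exists_eq_leftMulMatrix h'
    have hinj := Algebra.leftMulMatrix_injective
      (QuadraticAlgebra.basis (-(v : ZMod N)) (u : ZMod N))
    refine ⟨⟨x, y, hinj ?_, hinj ?_⟩, Units.ext ?_⟩
    · rw [map_mul, hx, hy, map_one, Units.mul_inv]
    · rw [map_mul, hx, hy, map_one, Units.inv_mul]
    · simpa using hx

theorem eq_of_castHom_eq {a b : ℕ} (hab : a.Coprime b) (ha : a ∣ N) (hb : b ∣ N) (hN : N = a * b)
    {x y : ZMod N} (h1 : ZMod.castHom ha (ZMod a) x = ZMod.castHom ha (ZMod a) y)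
    (h2 : ZMod.castHom hb (ZMod b) x = ZMod.castHom hb (ZMod b) y) : x = y := by
  obtain ⟨m, rfl⟩ := ZMod.intCast_surjective x
  obtain ⟨n, rfl⟩ := ZMod.intCast_surjective y
  simp only [map_intCast] at h1 h2
  rw [ZMod.intCast_eq_intCast_iff_dvd_sub] at h1 h2 ⊢
  rw [hN]
  push_cast
  exact IsCoprime.mul_dvd (Nat.isCoprime_iff_coprime.2 hab) h1 h2

theorem eq_of_forall_castHom_ordProj_eq (hN : N ≠ 0) {x y : ZMod N}
    (h : ∀ p ∈ N.primeFactors, ZMod.castHom (Nat.ordProj_dvd N p) (ZMod (p ^ N.factorization p)) x =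
      ZMod.castHom (Nat.ordProj_dvd N p) (ZMod (p ^ N.factorization p)) y) : x = y := by
  have : NeZero N := ⟨hN⟩
  rw [← sub_eq_zero]
  obtain ⟨m, hm⟩ := ZMod.natCast_zmod_surjective (x - y)
  rw [← hm, ZMod.natCast_eq_zero_iff, Nat.dvd_iff_prime_pow_dvd_dvd]
  intro p k hp hpk
  rcases k.eq_zero_or_pos with rfl | hk
  · simp
  have hpN : p ∣ N := (dvd_pow_self p hk.ne').trans hpk
  have h0 := h p (Nat.mem_primeFactors.2 ⟨hp, hpN, hN⟩)
  rw [← sub_eq_zero, ← map_sub, ← hm, map_natCast, ZMod.natCast_eq_zero_iff] at h0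
  exact (pow_dvd_pow p ((hp.pow_dvd_iff_le_factorization hN).1 hpk)).trans h0

theorem exists_idempotentAt (hN : N ≠ 0) {p : ℕ} (hp : p.Prime) : ∃ e : ZMod N, e * e = e ∧
    ZMod.castHom (Nat.ordProj_dvd N p) (ZMod (p ^ N.factorization p)) e = 1 ∧
    ZMod.castHom (Nat.ordCompl_dvd N p) (ZMod (N / p ^ N.factorization p)) e = 0 := by
  have hab : (p ^ N.factorization p).Coprime (N / p ^ N.factorization p) :=
    (Nat.coprime_ordCompl hp hN).pow_left _
  obtain ⟨m, h1, h2⟩ := Nat.chineseRemainder hab 1 0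
  have e1 : ZMod.castHom (Nat.ordProj_dvd N p) (ZMod (p ^ N.factorization p)) (m : ZMod N) = 1 := by
    rw [map_natCast]
    simpa using (ZMod.natCast_eq_natCast_iff _ _ _).2 h1
  have e2 : ZMod.castHom (Nat.ordCompl_dvd N p) (ZMod (N / p ^ N.factorization p)) (m : ZMod N)
      = 0 := by
    rw [map_natCast]
    simpa using (ZMod.natCast_eq_natCast_iff _ _ _).2 h2
  refine ⟨m, eq_of_castHom_eq hab (Nat.ordProj_dvd N p) (Nat.ordCompl_dvd N p)
    (Nat.ordProj_mul_ordCompl_eq_self N p).symm ?_ ?_, e1, e2⟩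
  · rw [map_mul, e1, mul_one]
  · rw [map_mul, e2, mul_zero]

theorem isInvolutionAt_iff (hN : N ≠ 0) {p : ℕ} (hp : p.Prime) {e : ZMod N} (he : e * e = e)
    (h1 : ZMod.castHom (Nat.ordProj_dvd N p) (ZMod (p ^ N.factorization p)) e = 1)
    (h2 : ZMod.castHom (Nat.ordCompl_dvd N p) (ZMod (N / p ^ N.factorization p)) e = 0)
    (w : GL (Fin 2) (ZMod N)) : IsInvolutionAt N u p w ↔ w = conjAtGL u e he := by
  have hab : (p ^ N.factorization p).Coprime (N / p ^ N.factorization p) :=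
    (Nat.coprime_ordCompl hp hN).pow_left _
  have e1 : (conjAt u e).map (ZMod.castHom (Nat.ordProj_dvd N p) (ZMod (p ^ N.factorization p))) =
      conjMatrix _ u := by rw [conjAt_map, h1, conjAt_one]
  have e2 : (conjAt u e).map (ZMod.castHom (Nat.ordCompl_dvd N p)
      (ZMod (N / p ^ N.factorization p))) = 1 := by rw [conjAt_map, h2, conjAt_zero]
  constructor
  · rintro ⟨w1, w2⟩
    refine Units.ext (Matrix.ext fun i j => ?_)
    refine eq_of_castHom_eq hab (Nat.ordProj_dvd N p) (Nat.ordCompl_dvd N p)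
      (Nat.ordProj_mul_ordCompl_eq_self N p).symm ?_ ?_
    · exact congrFun (congrFun (w1.trans e1.symm) i) j
    · exact congrFun (congrFun (w2.trans e2.symm) i) j
  · rintro rfl
    exact ⟨e1, e2⟩

/-- The element produced is the product of the involutions w_p for p in s. As an idempotent is
determined by the primes where it is 1, this covers all idempotents. -/
theorem exists_conjAtGL_mem (hN : N ≠ 0) (s : Finset ℕ) (hs : s ⊆ N.primeFactors) :
    ∃ (e : ZMod N) (he : e * e = e), conjAtGL u e he ∈ cartanStar N u v ∧
      ∀ p ∈ N.primeFactors, ZMod.castHom (Nat.ordProj_dvd N p) (ZMod (p ^ N.factorization p)) e =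
        if p ∈ s then 1 else 0 := by
  induction s using Finset.induction_on with
  | empty =>
    refine ⟨0, by simp, ?_, by simp⟩
    convert! one_mem (cartanStar N u v)
    exact Units.ext (conjAt_zero u)
  | insert p s hps ih =>
    obtain ⟨e, he, hmem, hval⟩ := ih ((Finset.subset_insert p s).trans hs)
    have hpN := hs (Finset.mem_insert_self p s)
    have hp := Nat.prime_of_mem_primeFactors hpN
    obtain ⟨f, hf, hf1, hf2⟩ := exists_idempotentAt hN hp
    have hfmem : conjAtGL u f hf ∈ cartanStar N u v :=
      Subgroup.mem_sup_right (Subgroup.subset_closure ⟨p, hp, Nat.dvd_of_mem_primeFactors hpN,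
        (isInvolutionAt_iff hN hp hf hf1 hf2 _).2 rfl⟩)
    refine ⟨e + f - 2 * e * f, symmDiff_idempotent he hf, ?_, ?_⟩
    · convert! mul_mem hmem hfmem
      exact Units.ext (conjAt_mul_conjAt u e f).symm
    · intro q hq
      by_cases hqp : q = p
      · subst hqp
        rw [if_pos (Finset.mem_insert_self _ _)]
        simp only [map_sub, map_add, map_mul, hf1, hval q hq, if_neg hps]
        ring
      · have hdvd : q ^ N.factorization q ∣ N / p ^ N.factorization p := by
          have hqq := Nat.prime_of_mem_primeFactors hq
          refine Nat.Coprime.dvd_of_dvd_mul_left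
            (Nat.coprime_pow_primes _ (N.factorization p) hqq hp hqp) ?_
          rw [Nat.ordProj_mul_ordCompl_eq_self]
          exact Nat.ordProj_dvd N q
        have hfq : ZMod.castHom (Nat.ordProj_dvd N q) (ZMod (q ^ N.factorization q)) f = 0 := by
          have := congrArg (ZMod.castHom hdvd (ZMod (q ^ N.factorization q))) hf2
          rw [map_zero, ← RingHom.comp_apply] at this
          rw [← this]
          congr 1
          exact Subsingleton.elim _ _
        simp only [map_sub, map_add, map_mul, hfq, hval q hq, Finset.mem_insert, hqp, false_or]
        ring

theorem conjAtGL_mem_cartanStar (hN : N ≠ 0) (e : ZMod N) (he : e * e = e) :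
    conjAtGL u e he ∈ cartanStar N u v := by
  classical
  obtain ⟨f, hf, hmem, hval⟩ := exists_conjAtGL_mem (u := u) (v := v) hN
    (N.primeFactors.filter fun p =>
      ZMod.castHom (Nat.ordProj_dvd N p) (ZMod (p ^ N.factorization p)) e = 1)
    (Finset.filter_subset _ _)
  have : e = f := by
    refine eq_of_forall_castHom_ordProj_eq hN fun p hp => ?_
    rw [hval p hp]
    simp only [Finset.mem_filter, hp, true_and]
    have : Fact p.Prime := ⟨Nat.prime_of_mem_primeFactors hp⟩
    have hk : N.factorization p ≠ 0 := by
      rwa [← Finsupp.mem_support_iff, Nat.support_factorization]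
    split_ifs with h
    · exact h
    · exact (idempotent_primePow hk (by rw [← map_mul, he])).resolve_right h
  subst this
  exact hmem

/-- If g twists α by e, then so does the involution `conjAtGL u e`, and their product commutes with
α, hence lies in the Cartan subgroup. -/
theorem cartanStar_eq (hN : N ≠ 0) : cartanStar N u v = twistedNormalizer N u v := by
  apply le_antisymm
  · refine sup_le ?_ ((Subgroup.closure_le _).2 ?_)
    · intro g hg
      exact ⟨0, by simp, by rw [twist_zero]; exact (mem_cartan_iff g).1 hg⟩
    · rintro w ⟨p, hp, -, hw⟩
      obtain ⟨e, he, h1, h2⟩ := exists_idempotentAt hN hp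
      rw [isInvolutionAt_iff hN hp he h1 h2] at hw
      subst hw
      exact ⟨e, he, conjAt_mul_alphaMatrix v he⟩
  · rintro g ⟨e, he, hg⟩
    have hw := conjAtGL_mem_cartanStar (u := u) (v := v) hN e he
    have hc : conjAtGL u e he * g ∈ cartanStar N u v := by
      refine Subgroup.mem_sup_left ((mem_cartan_iff _).2 ?_)
      have h := mul_twist (u := u) (e := e) (conjAt_mul_alphaMatrix (R := ZMod N) (u := u) v he)
      rw [twist_self_twist he] at h
      rw [Units.val_mul, mul_assoc, hg, ← mul_assoc]
      change conjAt u e * _ * _ = _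
      rw [h, mul_assoc]
      rfl
    simpa using mul_mem (inv_mem hw) hc

/-! ### Conjugates of `α` -/

section Conjugates

variable {N : ℕ} {u v : ℤ}

/-- The matrices with the same characteristic polynomial as `α`. -/
def IsAlphaLike (u v : ℤ) (X : Matrix (Fin 2) (Fin 2) (ZMod N)) : Prop :=
  X 0 0 + X 1 1 = u ∧ X 0 0 * X 1 1 - X 0 1 * X 1 0 = v

theorem isAlphaLike_iff {X : Matrix (Fin 2) (Fin 2) (ZMod N)} :
    IsAlphaLike u v X ↔ X.trace = u ∧ X.det = v := by
  rw [Matrix.trace_fin_two, Matrix.det_fin_two, IsAlphaLike]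

/-- The conjugate `s⁻¹ X s`. -/
def conjBy (s : SpecialLinearGroup (Fin 2) (ZMod N)) (X : Matrix (Fin 2) (Fin 2) (ZMod N)) :
    Matrix (Fin 2) (Fin 2) (ZMod N) :=
  (s⁻¹).val * X * s.val

variable {s t : SpecialLinearGroup (Fin 2) (ZMod N)} {X Y : Matrix (Fin 2) (Fin 2) (ZMod N)}

theorem val_mul_inv_val (s : SpecialLinearGroup (Fin 2) (ZMod N)) : s.val * (s⁻¹).val = 1 :=
  congrArg Subtype.val (mul_inv_cancel s)

theorem val_inv_mul_val (s : SpecialLinearGroup (Fin 2) (ZMod N)) : (s⁻¹).val * s.val = 1 :=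
  congrArg Subtype.val (inv_mul_cancel s)

theorem conjBy_eq_iff : conjBy s X = Y ↔ X * s.val = s.val * Y := by
  constructor
  · rintro rfl
    rw [conjBy, mul_assoc, ← mul_assoc, val_mul_inv_val, one_mul]
  · intro h
    rw [conjBy, mul_assoc, h, ← mul_assoc, val_inv_mul_val, one_mul]

theorem conjBy_mul : conjBy (s * t) X = conjBy t (conjBy s X) := by
  simp only [conjBy, _root_.mul_inv_rev s t]
  change (t⁻¹).val * (s⁻¹).val * X * (s.val * t.val) = _
  simp only [mul_assoc]

theorem conjBy_inv_conjBy : conjBy s⁻¹ (conjBy s X) = X := by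
  rw [← conjBy_mul, mul_inv_cancel]
  simp [conjBy]

theorem conjBy_conjBy_inv : conjBy s (conjBy s⁻¹ X) = X := by
  rw [← conjBy_mul, inv_mul_cancel]
  simp [conjBy]

theorem val_mul_eq_mul_val_iff :
    (t * s⁻¹).val * X = Y * (t * s⁻¹).val ↔ conjBy s X = conjBy t Y := by
  rw [eq_comm, ← conjBy_eq_iff, conjBy_mul]
  constructor
  · intro h
    rw [← h, conjBy_conjBy_inv]
  · intro h
    rw [← h, conjBy_inv_conjBy]

theorem conjBy_twist {e : ZMod N} : conjBy s (twist u e X) = twist u e (conjBy s X) := by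
  rw [conjBy_eq_iff]
  exact (mul_twist (conjBy_eq_iff.1 rfl).symm).symm

theorem IsAlphaLike.conjBy (h : IsAlphaLike u v X) : IsAlphaLike u v (conjBy s X) := by
  rw [isAlphaLike_iff] at h ⊢
  rw [NonsplitCartan.conjBy, Matrix.trace_mul_comm, ← mul_assoc, val_mul_inv_val, one_mul,
    Matrix.det_mul, Matrix.det_mul, (s⁻¹).2, s.2, one_mul, mul_one]
  exact h

theorem isAlphaLike_alphaMatrix : IsAlphaLike u v (alphaMatrix (ZMod N) u v) := by
  simp [IsAlphaLike, alphaMatrix]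

theorem twist_apply_zero_zero (e : ZMod N) : twist u e X 0 0 = X 0 0 + e * (u - 2 * X 0 0) := by
  simp [twist]

theorem twist_apply_zero_one (e : ZMod N) : twist u e X 0 1 = X 0 1 - e * (2 * X 0 1) := by
  simp [twist, sub_eq_add_neg]

theorem twist_apply_one_zero (e : ZMod N) : twist u e X 1 0 = X 1 0 - e * (2 * X 1 0) := by
  simp [twist, sub_eq_add_neg]

theorem twist_apply_one_one (e : ZMod N) : twist u e X 1 1 = X 1 1 + e * (u - 2 * X 1 1) := by
  simp [twist]

theorem IsAlphaLike.twist (h : IsAlphaLike u v X) {e : ZMod N} (he : e * e = e) :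
    IsAlphaLike u v (twist u e X) := by
  obtain ⟨h1, h2⟩ := h
  rw [IsAlphaLike, twist_apply_zero_zero, twist_apply_zero_one, twist_apply_one_zero,
    twist_apply_one_one]
  constructor
  · linear_combination (1 - 2 * e) * h1
  · rw [← h1]
    linear_combination h2 - (4 * X 0 1 * X 1 0 + (X 1 1 - X 0 0) ^ 2) * he

/-- The product -X₀₁X₁₀ is the polynomial X² - uX + v evaluated at X₀₀, which has no root modulo any
p dividing N. -/
theorem IsAlphaLike.isUnit (hN : N ≠ 0)
    (hr : ∀ p : ℕ, p.Prime → p ∣ N → ∀ r : ZMod p, r ^ 2 - u * r + v ≠ 0)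
    (h : IsAlphaLike u v X) : IsUnit (X 1 0) := by
  refine isUnit_of_mul_isUnit_right (x := -X 0 1) ?_
  have := isUnit_charpoly_eval hN hr (X 0 0)
  rwa [show -X 0 1 * X 1 0 = X 0 0 ^ 2 - u * X 0 0 + v by
    linear_combination h.2 - X 0 0 * h.1]

theorem IsAlphaLike.ext (hN : N ≠ 0)
    (hr : ∀ p : ℕ, p.Prime → p ∣ N → ∀ r : ZMod p, r ^ 2 - u * r + v ≠ 0)
    (hX : IsAlphaLike u v X) (hY : IsAlphaLike u v Y) (h0 : X 0 0 = Y 0 0)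
    (h1 : X 1 0 = Y 1 0) : X = Y := by
  have h3 : X 1 1 = Y 1 1 := by linear_combination hX.1 - hY.1 - h0
  have h2 : X 0 1 = Y 0 1 := by
    apply (hX.isUnit hN hr).mul_left_cancel
    linear_combination -hX.2 + hY.2 + X 1 1 * h0 + Y 0 0 * h3 - Y 0 1 * h1
  ext i j
  fin_cases i <;> fin_cases j <;> assumption

/-- Equality of the twists says (e - f)(u - 2X) = 0, and (u - 2X)² is the scalar u² - 4v, a unit. -/
theorem IsAlphaLike.twist_injective (hN : N ≠ 0)
    (hr : ∀ p : ℕ, p.Prime → p ∣ N → ∀ r : ZMod p, r ^ 2 - u * r + v ≠ 0)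
    (hX : IsAlphaLike u v X) {e f : ZMod N}
    (h : NonsplitCartan.twist u e X = NonsplitCartan.twist u f X) : e = f := by
  have h0 := congrFun (congrFun h 0) 0
  have h1 := congrFun (congrFun h 1) 0
  rw [twist_apply_zero_zero, twist_apply_zero_zero] at h0
  rw [twist_apply_one_zero, twist_apply_one_zero] at h1
  apply (isUnit_disc hN hr).mul_left_cancel
  linear_combination (u - 2 * X 0 0) * h0 - 2 * X 0 1 * h1 - 4 * (e - f) * X 0 0 * hX.1 +
    4 * (e - f) * hX.2

/-- The equation αs = sX forces the second column of s to be (αw - X₀₀w)/X₁₀, where w = (p, q) is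
the first. Then det s = N(w)/X₁₀ with N the norm, so w must have norm X₁₀. -/
theorem IsAlphaLike.exists_conjBy (hN : N ≠ 0)
    (hr : ∀ p : ℕ, p.Prime → p ∣ N → ∀ r : ZMod p, r ^ 2 - u * r + v ≠ 0)
    (hX : IsAlphaLike u v X) :
    ∃ s, NonsplitCartan.conjBy s (alphaMatrix (ZMod N) u v) = X := by
  have hc := hX.isUnit hN hr
  obtain ⟨p, q, hpq⟩ := exists_norm_eq hN hr _ hc
  obtain ⟨c', hc'⟩ := hc.exists_right_inv
  obtain ⟨h1, h2⟩ := hX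
  refine ⟨⟨!![p, c' * (-X 0 0 * p - v * q); q, c' * (-X 0 0 * q + p + u * q)], ?_⟩, ?_⟩
  · rw [Matrix.det_fin_two_of]
    linear_combination c' * hpq + hc'
  · refine conjBy_eq_iff.2 ?_
    have h3 : X 1 1 = u - X 0 0 := by linear_combination h1
    have h4 : X 0 1 = c' * (X 0 0 * (u - X 0 0) - v) := by
      rw [h3] at h2
      linear_combination -X 0 1 * hc' - c' * h2
    ext i j
    fin_cases i <;> fin_cases j <;>
      simp [alphaMatrix, Matrix.mul_apply, Fin.sum_univ_two, h3, h4]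
    · linear_combination (X 0 0 * p + v * q) * hc'
    · ring
    · linear_combination (X 0 0 * q - p - u * q) * hc'
    · ring

end Conjugates

/-! ### Cosets as classes of conjugates of `α` -/

section Cosets

variable {N : ℕ} {u v : ℤ}

theorem card_eq_mul_of_card_fiber {α β : Type*} [Finite α] [Finite β] (f : α → β) (n : ℕ)
    (h : ∀ b, Nat.card {a // f a = b} = n) : Nat.card α = Nat.card β * n := by
  have := Fintype.ofFinite β
  rw [← Nat.card_congr (Equiv.sigmaFiberEquiv f), Nat.card_sigma, Finset.sum_congr rfl
    fun b _ => h b, Finset.sum_const, Finset.card_univ, ← Nat.card_eq_fintype_card, smul_eq_mul]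

/-- The right coset of an element. -/
def coset (u v : ℤ) (x : SpecialLinearGroup (Fin 2) (ZMod N)) :
    RightCosets (slPart (cartanStar N u v)) :=
  Quotient.mk (QuotientGroup.rightRel _) x

theorem coset_surjective : Function.Surjective (coset (N := N) u v) := Quotient.mk_surjective

theorem op_smul_coset (s x : SpecialLinearGroup (Fin 2) (ZMod N)) :
    MulOpposite.op s • coset u v x = coset u v (x * s) := rfl

theorem coset_eq_iff (hN : N ≠ 0) (x y : SpecialLinearGroup (Fin 2) (ZMod N)) :
    coset u v x = coset u v y ↔ ∃ e : ZMod N, e * e = e ∧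
      conjBy x (alphaMatrix (ZMod N) u v) = twist u e (conjBy y (alphaMatrix (ZMod N) u v)) := by
  have h1 : coset u v x = coset u v y ↔ y * x⁻¹ ∈ slPart (cartanStar N u v) :=
    Quotient.eq.trans QuotientGroup.rightRel_apply
  rw [h1, slPart, cartanStar_eq hN]
  refine exists_congr fun e => and_congr_right fun he => ?_
  rw [← conjBy_twist]
  exact val_mul_eq_mul_val_iff

/-- Sending X = x⁻¹αx to the coset of x, each fibre over a fixed coset is a free orbit of the group
of twists, of size 2^ω(N). Twists commute, so one f serves for the whole orbit. -/
theorem card_fixedBy_mul (hN : N ≠ 0)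
    (hr : ∀ p : ℕ, p.Prime → p ∣ N → ∀ r : ZMod p, r ^ 2 - u * r + v ≠ 0)
    (s : SpecialLinearGroup (Fin 2) (ZMod N)) :
    Nat.card (MulAction.fixedBy (RightCosets (slPart (cartanStar N u v))) (MulOpposite.op s)) *
      2 ^ N.primeFactors.card =
    Nat.card {X : Matrix (Fin 2) (Fin 2) (ZMod N) // IsAlphaLike u v X ∧
      ∃ e : ZMod N, e * e = e ∧ conjBy s X = twist u e X} := by
  have : NeZero N := ⟨hN⟩
  have hfin : Finite (RightCosets (slPart (cartanStar N u v))) :=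
    Finite.of_surjective _ (coset_surjective (u := u) (v := v))
  have hfix : ∀ x, coset u v x ∈ MulAction.fixedBy (RightCosets (slPart (cartanStar N u v)))
      (MulOpposite.op s) ↔ ∃ e : ZMod N, e * e = e ∧
        conjBy s (conjBy x (alphaMatrix (ZMod N) u v)) =
          twist u e (conjBy x (alphaMatrix (ZMod N) u v)) := by
    intro x
    rw [MulAction.mem_fixedBy, op_smul_coset, coset_eq_iff hN]
    simp only [conjBy_mul]
  choose sec hsec using fun X : {X : Matrix (Fin 2) (Fin 2) (ZMod N) // IsAlphaLike u v X ∧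
      ∃ e : ZMod N, e * e = e ∧ conjBy s X = twist u e X} => X.2.1.exists_conjBy hN hr
  have hmem : ∀ X, coset u v (sec X) ∈ MulAction.fixedBy
      (RightCosets (slPart (cartanStar N u v))) (MulOpposite.op s) := by
    intro X
    rw [hfix, hsec]
    exact X.2.2
  symm
  refine card_eq_mul_of_card_fiber (fun X => ⟨coset u v (sec X), hmem X⟩) _ ?_
  · rintro ⟨ω, hω⟩
    obtain ⟨y, rfl⟩ := coset_surjective ω
    obtain ⟨f, hf, hy⟩ := (hfix y).1 hω
    have hA : IsAlphaLike u v (conjBy y (alphaMatrix (ZMod N) u v)) :=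
      isAlphaLike_alphaMatrix.conjBy
    rw [← card_idempotents hN]
    symm
    refine Nat.card_congr (Equiv.ofBijective (fun e => ⟨⟨twist u e.1
      (conjBy y (alphaMatrix (ZMod N) u v)), hA.twist e.2, f, hf, ?_⟩, ?_⟩) ⟨?_, ?_⟩)
    · rw [conjBy_twist, hy, twist_twist, twist_twist]
      congr 1
      ring
    · refine Subtype.ext ((coset_eq_iff hN _ _).2 ⟨e.1, e.2, ?_⟩)
      rw [hsec]
    · intro e e' h
      exact Subtype.ext (hA.twist_injective hN hr (congrArg (fun X => X.1.1) h))
    · rintro ⟨X, hX⟩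
      obtain ⟨e, he, h⟩ := (coset_eq_iff hN _ _).1 (congrArg Subtype.val hX)
      rw [hsec] at h
      exact ⟨⟨e, he⟩, Subtype.ext (Subtype.ext h.symm)⟩

end Cosets

/-! ### Elliptic points -/

section Counting

variable {N : ℕ} {u v : ℤ}

theorem matrix_two_ext_iff {R : Type*} {X Y : Matrix (Fin 2) (Fin 2) R} :
    X = Y ↔ X 0 0 = Y 0 0 ∧ X 0 1 = Y 0 1 ∧ X 1 0 = Y 1 0 ∧ X 1 1 = Y 1 1 := by
  constructor
  · rintro rfl
    exact ⟨rfl, rfl, rfl, rfl⟩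
  · rintro ⟨h1, h2, h3, h4⟩
    ext i j
    fin_cases i <;> fin_cases j <;> assumption

theorem conjBy_matS_eq_twist_iff {X : Matrix (Fin 2) (Fin 2) (ZMod N)} {e : ZMod N} :
    conjBy (matS N) X = twist u e X ↔ X 1 1 = X 0 0 + e * (u - 2 * X 0 0) ∧
      -X 1 0 = X 0 1 - e * (2 * X 0 1) ∧ -X 0 1 = X 1 0 - e * (2 * X 1 0) ∧
      X 0 0 = X 1 1 + e * (u - 2 * X 1 1) := by
  rw [conjBy_eq_iff, matrix_two_ext_iff, ← twist_apply_zero_zero, ← twist_apply_zero_one,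
    ← twist_apply_one_zero, ← twist_apply_one_one]
  simp only [matS, Matrix.mul_apply, Fin.sum_univ_two, of_apply, cons_val_zero, cons_val_one,
    cons_val', empty_val', cons_val_fin_one, mul_zero, mul_one, zero_add, mul_neg, zero_mul,
    neg_mul, one_mul, add_zero]
  constructor
  · rintro ⟨h1, h2, h3, h4⟩
    exact ⟨h3, by linear_combination h4, by linear_combination -h1, by linear_combination -h2⟩
  · rintro ⟨h1, h2, h3, h4⟩
    exact ⟨by linear_combination -h3, by linear_combination -h4, h1, by linear_combination h2⟩

theorem conjBy_matR_eq_twist_iff {X : Matrix (Fin 2) (Fin 2) (ZMod N)} {e : ZMod N} :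
    conjBy (matR N) X = twist u e X ↔
      X 0 1 = -(X 1 0 - e * (2 * X 1 0)) ∧
      -X 0 0 - X 0 1 = -(X 1 1 + e * (u - 2 * X 1 1)) ∧
      X 1 1 = X 0 0 + e * (u - 2 * X 0 0) - (X 1 0 - e * (2 * X 1 0)) ∧
      -X 1 0 - X 1 1 = X 0 1 - e * (2 * X 0 1) - (X 1 1 + e * (u - 2 * X 1 1)) := by
  rw [conjBy_eq_iff, matrix_two_ext_iff, ← twist_apply_zero_zero, ← twist_apply_zero_one (u := u),
    ← twist_apply_one_zero (u := u), ← twist_apply_one_one]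
  simp only [matR, Matrix.mul_apply, Fin.sum_univ_two, of_apply, cons_val_zero, cons_val_one,
    cons_val', empty_val', cons_val_fin_one, mul_zero, mul_one, zero_add, mul_neg, zero_mul,
    neg_mul, one_mul, ← sub_eq_add_neg, zero_sub]

theorem numElliptic2_mul (hN : N ≠ 0)
    (hr : ∀ p : ℕ, p.Prime → p ∣ N → ∀ r : ZMod p, r ^ 2 - u * r + v ≠ 0) :
    numElliptic2 (cartanStar N u v) * 2 ^ N.primeFactors.card =
      ∏ p ∈ N.primeFactors, if p = 2 then 2 ^ N.factorization p
        else if p % 4 = 1 then p ^ (N.factorization p - 1) * (p - 1)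
        else 2 + p ^ (N.factorization p - 1) * (p + 1) := by
  rw [← card_twisted_matS hN hr, numElliptic2, card_fixedBy_mul hN hr]
  symm
  refine Nat.card_congr (Equiv.ofBijective (fun x =>
    ⟨!![x.1 0, x.1 1; (2 * x.1 2 - 1) * x.1 1, u - x.1 0], ⟨?_, ?_⟩, x.1 2, x.2.1, ?_⟩) ⟨?_, ?_⟩)
  · simp
  · have := x.2.2.2
    simp
    linear_combination this
  · obtain ⟨x, h1, h2, h3⟩ := x
    rw [conjBy_matS_eq_twist_iff]
    simp only [of_apply, cons_val_zero, cons_val_one, cons_val', empty_val', cons_val_fin_one]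
    refine ⟨?_, ?_, ?_, ?_⟩
    · linear_combination -h2
    · ring
    · linear_combination 4 * x 1 * h1
    · linear_combination h2
  · rintro ⟨x, h1, h2, h3⟩ ⟨y, h1', h2', h3'⟩ hxy
    have hX := congrArg Subtype.val hxy
    simp only at hX
    have e0 : x 0 = y 0 := congrFun (congrFun hX 0) 0
    have e1 : x 1 = y 1 := congrFun (congrFun hX 0) 1
    have e2 : (2 * x 2 - 1) * x 1 = (2 * y 2 - 1) * y 1 := congrFun (congrFun hX 1) 0
    -- The matrix determines its idempotent, again because the discriminant is a unit.
    have e3 : x 2 = y 2 := by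
      apply (isUnit_disc hN hr).mul_left_cancel
      rw [← e0] at h2'
      rw [← e0, ← e1] at h3'
      rw [← e1] at e2
      linear_combination (u - 2 * x 0) * (h2 - h2') + 4 * (x 2 - y 2) * h3 +
        2 * (2 * x 2 - 1) * x 1 * e2
    refine Subtype.ext (funext fun i => ?_)
    fin_cases i <;> assumption
  · rintro ⟨X, ⟨h1, h2⟩, e, he, h⟩
    obtain ⟨k1, k2, k3, k4⟩ := conjBy_matS_eq_twist_iff.1 h
    have h3 : X 1 1 = u - X 0 0 := by linear_combination h1
    have h4 : X 1 0 = (2 * e - 1) * X 0 1 := by linear_combination -k2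
    refine ⟨⟨![X 0 0, X 0 1, e], he, ?_, ?_⟩, Subtype.ext ?_⟩
    · simp
      linear_combination h3 - k1
    · simp
      rw [h3, h4] at h2
      linear_combination h2
    · rw [matrix_two_ext_iff]
      simp [h3, h4]

theorem numElliptic3_mul (hN : N ≠ 0)
    (hr : ∀ p : ℕ, p.Prime → p ∣ N → ∀ r : ZMod p, r ^ 2 - u * r + v ≠ 0) :
    numElliptic3 (cartanStar N u v) * 2 ^ N.primeFactors.card =
      ∏ p ∈ N.primeFactors, if p % 3 = 2 then 2 else 0 := by
  rw [← card_commuting_matR hN hr, numElliptic3, card_fixedBy_mul hN hr]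
  symm
  refine Nat.card_congr (Equiv.ofBijective (fun s =>
    ⟨!![s.1, -(2 * s.1 - u); 2 * s.1 - u, u - s.1], ⟨?_, ?_⟩, 0, by simp, ?_⟩) ⟨?_, ?_⟩)
  · simp
  · have := s.2
    simp
    linear_combination this
  · rw [conjBy_matR_eq_twist_iff]
    simp only [of_apply, cons_val_zero, cons_val_one, cons_val', empty_val', cons_val_fin_one]
    refine ⟨?_, ?_, ?_, ?_⟩ <;> ring
  · intro s t h
    exact Subtype.ext (congrFun (congrFun (congrArg Subtype.val h) 0) 0)
  · rintro ⟨X, hX, e, he, h⟩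
    obtain ⟨k1, k2, k3, k4⟩ := conjBy_matR_eq_twist_iff.1 h
    obtain ⟨h1, h2⟩ := hX
    have h3 : X 1 1 = u - X 0 0 := by linear_combination h1
    -- Conceptually, R has order 3 while twisting by e is an involution, so the twist is trivial.
    -- Entrywise, e kills u - 2X and hence the discriminant.
    have he0 : e = 0 := by
      have b0 : e * X 0 1 = 0 := by
        linear_combination -e * k2 - e * h1 + (u - 2 * X 1 1) * he
      have c0 : e * X 1 0 = 0 := by
        linear_combination b0 - e * k1 - 2 * X 1 0 * he
      have d0 : e * (u - 2 * X 1 1) = 0 := by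
        linear_combination e * k4 + c0 - b0 - (u + 2 * X 0 1 - 2 * X 1 1) * he
      apply (isUnit_disc hN hr).mul_left_cancel
      rw [h3] at h2 d0
      linear_combination 4 * e * h2 + (2 * X 0 0 - u) * d0 + 4 * X 0 1 * c0
    subst he0
    have h4 : X 1 0 = 2 * X 0 0 - u := by linear_combination k3 - h3
    have h5 : X 0 1 = -(2 * X 0 0 - u) := by linear_combination k1 - h4
    refine ⟨⟨X 0 0, ?_⟩, Subtype.ext ?_⟩
    · rw [h3, h4, h5] at h2
      linear_combination h2
    · rw [matrix_two_ext_iff]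
      simp [h3, h4, h5]

/-! ### Cusps -/

theorem matT_zpow (j : ℤ) : ((matT N) ^ j).val = !![1, (j : ZMod N); 0, 1] := by
  let U : Multiplicative (ZMod N) →* SpecialLinearGroup (Fin 2) (ZMod N) :=
    { toFun := fun t => ⟨!![1, t.toAdd; 0, 1], by simp⟩
      map_one' := by
        ext i j
        fin_cases i <;> fin_cases j <;> simp
      map_mul' := fun s t => by
        apply Subtype.ext
        change _ = !![1, s.toAdd; 0, 1] * !![1, t.toAdd; 0, 1]
        rw [matrix_two_ext_iff]
        simp [add_comm] }
  have h : matT N = U (Multiplicative.ofAdd 1) := rfl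
  rw [h, ← map_zpow, ← ofAdd_zsmul]
  change !![1, j • (1 : ZMod N); 0, 1] = _
  simp

theorem conjBy_matT_zpow_zero_zero (j : ℤ) (X : Matrix (Fin 2) (Fin 2) (ZMod N)) :
    conjBy (matT N ^ j) X 0 0 = X 0 0 - j * X 1 0 := by
  rw [conjBy, ← _root_.zpow_neg, matT_zpow, matT_zpow]
  simp [Matrix.vecMul, dotProduct, Matrix.mul_apply, Fin.sum_univ_two, sub_eq_add_neg]

theorem conjBy_matT_zpow_one_zero (j : ℤ) (X : Matrix (Fin 2) (Fin 2) (ZMod N)) :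
    conjBy (matT N ^ j) X 1 0 = X 1 0 := by
  rw [conjBy, ← _root_.zpow_neg, matT_zpow, matT_zpow]
  simp [Matrix.vecMul, dotProduct, Matrix.mul_apply, Fin.sum_univ_two]

/-- The matrix with the characteristic polynomial of `α` and first column `(0, c)`. -/
def cuspMatrix (u v : ℤ) (c : (ZMod N)ˣ) : Matrix (Fin 2) (Fin 2) (ZMod N) :=
  !![0, -v * (c⁻¹ : (ZMod N)ˣ); c, u]

theorem isAlphaLike_cuspMatrix (c : (ZMod N)ˣ) : IsAlphaLike u v (cuspMatrix u v c) := by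
  constructor <;> simp [cuspMatrix]

theorem mk_coset_eq_iff (x y : SpecialLinearGroup (Fin 2) (ZMod N)) :
    (Quotient.mk (MulAction.orbitRel (Subgroup.zpowers (MulOpposite.op (matT N)))
        (RightCosets (slPart (cartanStar N u v)))) (coset u v x) =
      Quotient.mk _ (coset u v y)) ↔ ∃ j : ℤ, coset u v (y * matT N ^ j) = coset u v x := by
  rw [Quotient.eq, MulAction.orbitRel_apply, MulAction.mem_orbit_iff]
  constructor
  · rintro ⟨⟨g, hg⟩, h⟩
    obtain ⟨j, rfl⟩ := Subgroup.mem_zpowers_iff.1 hg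
    refine ⟨j, ?_⟩
    rw [← h, ← op_smul_coset, MulOpposite.op_zpow]
    rfl
  · rintro ⟨j, h⟩
    refine ⟨⟨MulOpposite.op (matT N) ^ j, j, rfl⟩, ?_⟩
    rw [← h, ← op_smul_coset, MulOpposite.op_zpow]
    rfl

theorem numCusps_mul (hN : N ≠ 0)
    (hr : ∀ p : ℕ, p.Prime → p ∣ N → ∀ r : ZMod p, r ^ 2 - u * r + v ≠ 0) :
    numCusps (cartanStar N u v) *
      Nat.card {s : ZMod N // ∃ e, e * e = e ∧ s = 1 - 2 * e} = N.totient := by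
  have : NeZero N := ⟨hN⟩
  have hfin : Finite (RightCosets (slPart (cartanStar N u v))) :=
    Finite.of_surjective _ (coset_surjective (u := u) (v := v))
  have hfin' : Finite (MulAction.orbitRel.Quotient (Subgroup.zpowers (MulOpposite.op (matT N)))
    (RightCosets (slPart (cartanStar N u v)))) := Quotient.finite _
  choose sec hsec using fun c : (ZMod N)ˣ =>
    (isAlphaLike_cuspMatrix (u := u) (v := v) c).exists_conjBy hN hr
  have hiff : ∀ c d : (ZMod N)ˣ,
      (Quotient.mk (MulAction.orbitRel (Subgroup.zpowers (MulOpposite.op (matT N)))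
        (RightCosets (slPart (cartanStar N u v)))) (coset u v (sec c)) =
      Quotient.mk _ (coset u v (sec d))) ↔
      ∃ s : ZMod N, (∃ e, e * e = e ∧ s = 1 - 2 * e) ∧ (c : ZMod N) = s * d := by
    intro c d
    rw [eq_comm, mk_coset_eq_iff]
    constructor
    · rintro ⟨j, h⟩
      obtain ⟨e, he, h⟩ := (coset_eq_iff hN _ _).1 h
      rw [conjBy_mul, hsec, hsec] at h
      refine ⟨1 - 2 * e, ⟨e, he, rfl⟩, ?_⟩
      have h10 := congrFun (congrFun h 1) 0
      rw [conjBy_matT_zpow_one_zero, twist_apply_one_zero] at h10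
      simp only [cuspMatrix, of_apply, cons_val_zero, cons_val_one, cons_val', empty_val',
        cons_val_fin_one] at h10
      linear_combination h10
    · rintro ⟨s, ⟨e, he, rfl⟩, hcd⟩
      -- Chosen so that the upper left entry 0 - jc equals eu, that of the twisted cusp matrix.
      obtain ⟨j, hj⟩ := ZMod.intCast_surjective (n := N) (-e * u * (c⁻¹ : (ZMod N)ˣ))
      refine ⟨j, (coset_eq_iff hN _ _).2 ⟨e, he, ?_⟩⟩
      rw [conjBy_mul, hsec, hsec]
      refine IsAlphaLike.ext hN hr (isAlphaLike_cuspMatrix c).conjBy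
        ((isAlphaLike_cuspMatrix d).twist he) ?_ ?_
      · rw [conjBy_matT_zpow_zero_zero, twist_apply_zero_zero, hj]
        simp [cuspMatrix]
      · rw [conjBy_matT_zpow_one_zero, twist_apply_one_zero]
        simp only [cuspMatrix, of_apply, cons_val_zero, cons_val_one, cons_val', empty_val',
          cons_val_fin_one]
        linear_combination hcd
  have hsurj : ∀ q : MulAction.orbitRel.Quotient (Subgroup.zpowers (MulOpposite.op (matT N)))
      (RightCosets (slPart (cartanStar N u v))), ∃ c, Quotient.mk _ (coset u v (sec c)) = q := by
    intro q
    obtain ⟨ω, rfl⟩ := Quotient.mk_surjective q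
    obtain ⟨x, rfl⟩ := coset_surjective ω
    have hX : IsAlphaLike u v (conjBy x (alphaMatrix (ZMod N) u v)) :=
      isAlphaLike_alphaMatrix.conjBy
    obtain ⟨c, hc⟩ := hX.isUnit hN hr
    -- This translation makes the upper left entry zero, reaching the cusp matrix with the same c.
    obtain ⟨j, hj⟩ := ZMod.intCast_surjective (n := N)
      (conjBy x (alphaMatrix (ZMod N) u v) 0 0 * (c⁻¹ : (ZMod N)ˣ))
    refine ⟨c, (mk_coset_eq_iff _ _).2 ⟨j, (coset_eq_iff hN _ _).2 ⟨0, by simp, ?_⟩⟩⟩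
    rw [conjBy_mul, twist_zero, hsec]
    refine IsAlphaLike.ext hN hr hX.conjBy (isAlphaLike_cuspMatrix c) ?_ ?_
    · rw [conjBy_matT_zpow_zero_zero, hj, ← hc]
      simp [cuspMatrix]
    · rw [conjBy_matT_zpow_one_zero, ← hc]
      simp [cuspMatrix]
  rw [← ZMod.card_units_eq_totient, ← Nat.card_eq_fintype_card (α := (ZMod N)ˣ)]
  symm
  refine card_eq_mul_of_card_fiber (fun c => Quotient.mk _ (coset u v (sec c))) _ fun q => ?_
  obtain ⟨d, rfl⟩ := hsurj q
  symm
  have hs : ∀ s : {s : ZMod N // ∃ e, e * e = e ∧ s = 1 - 2 * e}, s.1 * s.1 = 1 := by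
    rintro ⟨s, e, he, rfl⟩
    linear_combination 4 * he
  -- The fibre through d is the set of multiples of d by signs; each sign is its own inverse.
  refine Nat.card_congr (Equiv.ofBijective
    (fun s => ⟨⟨s.1, s.1, hs s, hs s⟩ * d, (hiff _ _).2 ⟨s.1, s.2, rfl⟩⟩) ⟨?_, ?_⟩)
  · intro s t h
    exact Subtype.ext (congrArg Units.val (mul_right_cancel (congrArg Subtype.val h)))
  · rintro ⟨c, hc⟩
    obtain ⟨s, hs', h⟩ := (hiff _ _).1 hc
    exact ⟨⟨s, hs'⟩, Subtype.ext (Units.ext h.symm)⟩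

end Counting

end NonsplitCartan

end

/-! ### The final formulas -/

theorem corollary4p5 (N : ℕ) (hN : 0 < N) (u v : ℤ) (huv : NonsplitCartan.IsNonsplit N u v) :
    (NonsplitCartan.numCusps (NonsplitCartan.cartanStar N u v) : ℚ) =
        (if 2 ∣ N ∧ ¬ 2 ^ 2 ∣ N then
          (Nat.totient N : ℚ) / 2 ^ (N.primeFactors.card - 1)
        else (Nat.totient N : ℚ) / 2 ^ N.primeFactors.card) ∧
      ((∀ p : ℕ, p.Prime → p ∣ N → p % 3 = 2) →
        NonsplitCartan.numElliptic3 (NonsplitCartan.cartanStar N u v) = 1) ∧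
      ((¬ ∀ p : ℕ, p.Prime → p ∣ N → p % 3 = 2) →
        NonsplitCartan.numElliptic3 (NonsplitCartan.cartanStar N u v) = 0) ∧
      (NonsplitCartan.numElliptic2 (NonsplitCartan.cartanStar N u v) : ℚ) =
        (if 2 ∣ N then (2 : ℚ) ^ (N.factorization 2 - 1) else 1) *
          (∏ p ∈ N.primeFactors with p % 4 = 1,
            (p : ℚ) ^ (N.factorization p - 1) * ((p : ℚ) - 1) / 2) *
          ∏ p ∈ N.primeFactors with p % 4 = 3,
            (1 + (p : ℚ) ^ (N.factorization p - 1) * ((p : ℚ) + 1) / 2) := by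
  have hN0 : N ≠ 0 := hN.ne'
  have hr := huv.charpoly_ne_zero
  refine ⟨?_, fun h => ?_, fun h => ?_, ?_⟩
  · have key := NonsplitCartan.numCusps_mul hN0 hr
    rw [NonsplitCartan.card_signs hN0] at key
    rw [← key]
    split_ifs <;> push_cast <;> field_simp
  · have key := NonsplitCartan.numElliptic3_mul hN0 hr
    rw [Finset.prod_congr rfl fun p hp => if_pos (h p (Nat.prime_of_mem_primeFactors hp)
      (Nat.dvd_of_mem_primeFactors hp)), Finset.prod_const] at key
    exact Nat.eq_of_mul_eq_mul_right (by positivity) (key.trans (one_mul _).symm)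
  · have key := NonsplitCartan.numElliptic3_mul hN0 hr
    push Not at h
    obtain ⟨p, hp, hpN, hp3⟩ := h
    rw [Finset.prod_eq_zero (Nat.mem_primeFactors.2 ⟨hp, hpN, hN0⟩) (if_neg hp3)] at key
    exact (mul_eq_zero.1 key).resolve_right (by positivity)
  · have key := congrArg (Nat.cast (R := ℚ)) (NonsplitCartan.numElliptic2_mul hN0 hr)
    push_cast at key
    have h2 : (if 2 ∣ N then (2 : ℚ) ^ (N.factorization 2 - 1) else 1) =
        ∏ p ∈ N.primeFactors, if p = 2 then (2 : ℚ) ^ (N.factorization p - 1) else 1 := by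
      rw [Finset.prod_ite_eq']
      exact if_congr (by simp [hN0, Nat.prime_two]) rfl rfl
    rw [h2, Finset.prod_filter, Finset.prod_filter, ← Finset.prod_mul_distrib,
      ← Finset.prod_mul_distrib]
    -- Distributing one factor 2 to each prime reduces the identity to a comparison of local
    -- factors.
    refine mul_right_cancel₀ (b := (2 : ℚ) ^ N.primeFactors.card) (by positivity) ?_
    rw [key, ← Finset.prod_const, ← Finset.prod_mul_distrib]
    refine Finset.prod_congr rfl fun p hp => ?_
    have hpp := Nat.prime_of_mem_primeFactors hp
    have hk : N.factorization p ≠ 0 := by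
      rwa [← Finsupp.mem_support_iff, Nat.support_factorization]
    rcases hpp.eq_two_or_odd with rfl | hodd
    · simp only [if_true]
      norm_num
      rw [← pow_succ, Nat.sub_add_cancel (Nat.pos_of_ne_zero hk)]
    · have hp2 : p ≠ 2 := by rintro rfl; omega
      rw [if_neg hp2, if_neg hp2]
      by_cases h1 : p % 4 = 1
      · rw [if_pos h1, if_pos h1, if_neg (by omega)]
        rw [Nat.cast_sub hpp.one_le]
        push_cast
        ring
      · rw [if_neg h1, if_neg h1, if_pos (by omega)]
        ring
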